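/- Let $\mathbb F$ be a field of characteristic $0$ and let $\mathcal V$ be a differential algebra over $\mathbb F$, i.e. a unital commutative associative $\mathbb F$-algebra with an $\mathbb F$-linear derivation $\partial$. **Conventions.** $\mathcal V_{\lambda,\mu}=\mathcal V[[\lambda^{-1},\mu^{-1},(\lambda+\mu)^{-1}]][\lambda,\mu]$ denotes the quotient of $\mathcal V[[\lambda^{-1},\mu^{-1},\nu^{-1}]][\lambda,\mu,\nu]$ by its submodule $(\nu-\lambda-\mu)\mathcal V[[\lambda^{-1},\mu^{-1},\nu^{-1}]][\lambda,\mu,\nu]$. It embeds in $\mathcal V((\lambda^{-1}))((\mu^{-1}))$, in $\mathcal V((\mu^{-1}))((\lambda^{-1}))$ and in $\mathcal V(((\lambda+\mu)^{-1}))((\lambda^{-1}))$ by geometric expansion in the domains $|\mu|>|\lambda|$, $|\lambda|>|\mu|$ and $|\lambda|>|\lambda+\mu|$ respectively, and is identified with its images. For $A(\lambda)=\sum_{n\le N}a_n\lambda^n\in\mathcal V((\lambda^{-1}))$ and $B(\lambda)\in\mathcal V((\lambda^{-1}))$ put $A(\lambda+\partial)B(\lambda)=\sum_n a_n(\lambda+\partial)^nB(\lambda)$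 and $A(-\lambda-\partial)=\sum_n(-\lambda-\partial)^na_n$, with powers expanded in non-negative powers of $\partial$, acting on the coefficients to their right; if $A(\lambda)=\{a_\lambda b\}$, write $\{a_{\lambda+\partial}b\}_\to B(\lambda)$ for $A(\lambda+\partial)B(\lambda)$ and $\{a_{-\lambda-\partial}b\}$ for $A(-\lambda-\partial)$. A (non-local) *PVA $\lambda$-bracket* on $\mathcal V$ is an $\mathbb F$-bilinear map $\{\cdot\,_\lambda\,\cdot\}:\mathcal V\times\mathcal V\to\mathcal V((\lambda^{-1}))$ such that, for all $a,b,c\in\mathcal V$: - $\{\partial a_\lambda b\}=-\lambda\{a_\lambda b\}$ and $\{a_\lambda\partial b\}=(\lambda+\partial)\{a_\lambda b\}$; - $\{a_\lambda bc\}=b\{a_\lambda c\}+c\{a_\lambda b\}$ and $\{ab_\lambda c\}=\{a_{\lambda+\partial}c\}_\to b+\{b_{\lambda+\partial}c\}_\to a$; - $\{b_\lambda a\}=-\{a_{-\lambda-\partial}b\}$; - $\{a_\lambda\{b_\mu c\}\}\in\mathcal V_{\lambda,\mu}$; - $\{a_\lambda\{b_\mu c\}\}-\{b_\mu\{a_\lambda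 c\}\}=\{\{a_\lambda b\}_{\lambda+\mu}c\}$ in $\mathcal V_{\lambda,\mu}$. Two PVA $\lambda$-brackets on $\mathcal V$ are *compatible* if all their $\mathbb F$-linear combinations are PVA $\lambda$-brackets. A *PVA ideal* for such a bracket is an ideal $\mathcal J\subset\mathcal V$ with $\partial\mathcal J\subset\mathcal J$ and $\{\mathcal J_\lambda\mathcal V\},\{\mathcal V_\lambda\mathcal J\}\subset\mathcal J((\lambda^{-1}))$. **Theorem.** Let $\{\cdot\,_\lambda\,\cdot\}_0$ and $\{\cdot\,_\lambda\,\cdot\}_1$ be compatible PVA $\lambda$-brackets on $\mathcal V$, and let $\theta_1,\dots,\theta_m\in\mathcal V$ be central for the first one: $\{a_\lambda\theta_i\}_0=0$ for all $a\in\mathcal V$ and all $i$. Let $C(\partial)$ be the $m\times m$ matrix pseudodifferential operator over $\mathcal V((\partial^{-1}))$ with symbol $C_{\alpha\beta}(\lambda)=\{{\theta_\beta}_\lambda\theta_\alpha\}_1$, suppose that it is invertible, and let $C^{-1}(\partial)$ be its two-sided inverse. Let $$\{a_\lambda b\}_1^D=\{a_\lambda b\}_1-\sum_{\alpha,\beta=1}^m\{{\theta_\beta}_{\lambda+\partial}b\}_{1\,\to}\,(C^{-1})_{\beta\alpha}(\lambda+\partial)\,\{a_\lambda\theta_\alpha\}_1$$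 be the Dirac modification of the second bracket. Then $\{\cdot\,_\lambda\,\cdot\}_0$ and $\{\cdot\,_\lambda\,\cdot\}_1^D$ are compatible PVA $\lambda$-brackets on $\mathcal V$. Moreover, the differential ideal $\mathcal I$ of $\mathcal V$ generated by $\theta_1,\dots,\theta_m$ (the smallest ideal that contains them and is stable under $\partial$) is a PVA ideal for both of these brackets, and the brackets they induce on the quotient differential algebra $\mathcal V/\mathcal I$ are well-defined compatible PVA $\lambda$-brackets. -/

import Mathlib

namespace NonlocalPVA

/-! ### Formal Laurent series in `λ⁻¹`

The space `V((λ⁻¹))` is Mathlib's `LaurentSeries V`, whose formal variable is read as `λ⁻¹`; so the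
coefficient of `λ ^ n` of a series `A` is `A.coeff (-n)`. -/

section Series

variable {V : Type*}

/-- The coefficient of `λ ^ n` of a series in `V((λ⁻¹))`. -/
def lc [Zero V] (A : LaurentSeries V) (n : ℤ) : V := A.coeff (-n)

/-- The series `∑ f n * λ ^ n` in `V((λ⁻¹))`, for a family `f` that vanishes for large `n`. -/
def mkSeries [Zero V] (f : ℤ → V) (h : ∃ N : ℤ, ∀ n, N < n → f n = 0) : LaurentSeries V :=
  HahnSeries.ofSuppBddBelow (fun n => f (-n)) (by
    obtain ⟨N, hN⟩ := h
    refine ⟨-N, fun n hn => ?_⟩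
    by_contra hlt
    exact hn (hN _ (by omega)))

theorem lc_mkSeries [Zero V] (f : ℤ → V) (h : ∃ N : ℤ, ∀ n, N < n → f n = 0) (n : ℤ) :
    lc (mkSeries f h) n = f n := by
  simp [lc, mkSeries]

theorem exists_lc_bound [Zero V] (A : LaurentSeries V) : ∃ N : ℤ, ∀ n, N < n → lc A n = 0 :=
  ⟨-A.order, fun _ hn => HahnSeries.coeff_eq_zero_of_lt_order (by omega)⟩

theorem lc_ext [Zero V] {A B : LaurentSeries V} (h : ∀ n, lc A n = lc B n) : A = B := by
  ext n
  simpa [lc] using h (-n)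

/-- Multiplication by `λ` on `V((λ⁻¹))`. -/
noncomputable def lamMul [CommRing V] (A : LaurentSeries V) : LaurentSeries V :=
  HahnSeries.single (-1 : ℤ) (1 : V) * A

end Series

/-! ### Sums weighted by binomial coefficients -/

section BinomSum

variable {V : Type*} [AddCommGroup V]

/-- The sum `∑_{n ∈ ℤ, k ≥ 0} (n choose k) * T n k`. In all its uses below only finitely many terms
are nonzero. It comes from `(x + y) ^ n = ∑_{k ≥ 0} (n choose k) * x ^ (n - k) * y ^ k`, the
expansion in non-negative powers of `y` for `n ∈ ℤ`. -/
noncomputable def binomSum (T : ℤ → ℕ → V) : V :=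
  ∑ᶠ x : ℤ × ℕ, Ring.choose x.1 x.2 • T x.1 x.2

/-- A sufficient condition for a family to be finitely supported. -/
def BddFamily (T : ℤ → ℕ → V) : Prop :=
  ∃ N j : ℤ, ∀ n k, T n k ≠ 0 → n ≤ N ∧ j + k ≤ n

theorem BddFamily.finite {T : ℤ → ℕ → V} (h : BddFamily T) :
    (Function.support fun x : ℤ × ℕ => T x.1 x.2).Finite := by
  obtain ⟨N, j, h⟩ := h
  refine ((Set.finite_Icc j N).prod (Set.finite_Iic (N - j).toNat)).subset ?_
  rintro ⟨n, k⟩ hx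
  obtain ⟨h1, h2⟩ := h n k hx
  simp only [Set.mem_prod, Set.mem_Icc, Set.mem_Iic]
  omega

theorem BddFamily.finite_smul {T : ℤ → ℕ → V} (h : BddFamily T) (c : ℤ → ℕ → ℤ) :
    (Function.support fun x : ℤ × ℕ => c x.1 x.2 • T x.1 x.2).Finite :=
  h.finite.subset fun x hx h0 => hx (by
    have h0' : T x.1 x.2 = 0 := h0
    simp [h0'])

theorem binomSum_add {S T : ℤ → ℕ → V} (hS : BddFamily S) (hT : BddFamily T) :
    binomSum (fun n k => S n k + T n k) = binomSum S + binomSum T := by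
  unfold binomSum
  rw [← finsum_add_distrib (hS.finite_smul _) (hT.finite_smul _)]
  simp only [smul_add]

theorem binomSum_smul {F : Type*} [Field F] [Module F V] (c : F) (T : ℤ → ℕ → V)
    (hT : BddFamily T) : binomSum (fun n k => c • T n k) = c • binomSum T := by
  unfold binomSum
  rw [smul_finsum' c (hT.finite_smul _)]
  simp only [smul_comm c]

theorem binomSum_eq_zero {T : ℤ → ℕ → V} (hT : ∀ n k, T n k = 0) : binomSum T = 0 := by
  unfold binomSum
  simp [hT]

/-- The form that Pascal's rule takes for `binomSum`. -/
theorem binomSum_pascal {T : ℤ → ℕ → V} (hT : BddFamily T) :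
    binomSum (fun n k => T (n - 1) k - T n (k + 1) - T n k) = 0 := by
  obtain ⟨N, j, h⟩ := id hT
  have h1 : BddFamily fun n k => T (n - 1) k :=
    ⟨N + 1, j, fun n k hk => by have := h _ _ hk; omega⟩
  have h2 : BddFamily fun n k => T n (k + 1) :=
    ⟨N, j, fun n k hk => by have := h _ _ hk; omega⟩
  have e1 : (∑ᶠ x : ℤ × ℕ, Ring.choose x.1 x.2 • T (x.1 - 1) x.2)
      = ∑ᶠ x : ℤ × ℕ, Ring.choose (x.1 + 1) x.2 • T x.1 x.2 := by
    rw [← finsum_comp_equiv ((Equiv.addRight (1 : ℤ)).prodCongr (Equiv.refl ℕ))]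
    refine finsum_congr fun x => ?_
    simp
  have e2 : (∑ᶠ x : ℤ × ℕ, Ring.choose x.1 x.2 • T x.1 (x.2 + 1))
      = ∑ᶠ x : ℤ × ℕ, (Ring.choose (x.1 + 1) x.2 - Ring.choose x.1 x.2) • T x.1 x.2 := by
    have hinj : Function.Injective fun x : ℤ × ℕ => (x.1, x.2 + 1) := by
      rintro ⟨a, b⟩ ⟨c, d⟩ hx
      simpa using hx
    rw [← finsum_mem_univ (f := fun x : ℤ × ℕ =>
      (Ring.choose (x.1 + 1) x.2 - Ring.choose x.1 x.2) • T x.1 x.2)]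
    have hr : (∑ᶠ x ∈ Set.range (fun x : ℤ × ℕ => (x.1, x.2 + 1)),
        (Ring.choose (x.1 + 1) x.2 - Ring.choose x.1 x.2) • T x.1 x.2)
        = ∑ᶠ x : ℤ × ℕ, Ring.choose x.1 x.2 • T x.1 (x.2 + 1) := by
      rw [finsum_mem_range hinj]
      refine finsum_congr fun x => ?_
      simp only
      rw [Ring.choose_succ_succ, add_sub_cancel_right]
    rw [← hr]
    refine finsum_mem_inter_support_eq' _ _ _ fun x hx => ?_
    simp only [Set.mem_univ, iff_true, Set.mem_range]
    rcases x with ⟨n, k⟩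
    cases k with
    | zero => simp at hx
    | succ k => exact ⟨(n, k), rfl⟩
  have f1 := h1.finite_smul fun n k => Ring.choose n k
  have f2 := h2.finite_smul fun n k => Ring.choose n k
  have f3 := hT.finite_smul fun n k => Ring.choose n k
  have f4 := hT.finite_smul fun n k => Ring.choose (n + 1) k
  have f5 := hT.finite_smul fun n k => Ring.choose (n + 1) k - Ring.choose n k
  have f12 := (f1.union f2).subset (Function.support_sub _ _)
  have f45 := (f4.union f5).subset (Function.support_sub _ _)
  unfold binomSum
  simp only [smul_sub]
  rw [finsum_sub_distrib f12 f3, finsum_sub_distrib f1 f2, e1, e2, ← finsum_sub_distrib f4 f5,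
    ← finsum_sub_distrib f45 f3]
  refine finsum_eq_zero_of_forall_eq_zero fun x => ?_
  simp only [sub_smul]
  abel

end BinomSum

/-! ### The space `V_{λ,μ}` -/

section TwoVariables

variable (F : Type*) [Field F] (V : Type*) [AddCommGroup V] [Module F V]

/-- The space `V[[λ⁻¹, μ⁻¹, ν⁻¹]][λ, μ, ν]`: families `P` of coefficients, `P m n p` being the
coefficient of `λ ^ m * μ ^ n * ν ^ p`, such that all three exponents are bounded above. -/
def Series3 : Submodule F (ℤ → ℤ → ℤ → V) where
  carrier := {P | ∃ N : ℤ, ∀ m n p, (N < m ∨ N < n ∨ N < p) → P m n p = 0}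
  zero_mem' := ⟨0, fun _ _ _ _ => rfl⟩
  add_mem' := by
    rintro P Q ⟨M, hM⟩ ⟨N, hN⟩
    refine ⟨max M N, fun m n p h => ?_⟩
    simp only [Pi.add_apply]
    rw [hM m n p (by omega), hN m n p (by omega), add_zero]
  smul_mem' := by
    rintro c P ⟨N, hN⟩
    refine ⟨N, fun m n p h => ?_⟩
    simp only [Pi.smul_apply]
    rw [hN m n p h, smul_zero]

variable {F V}

/-- Multiplication by `ν - λ - μ`. -/
def relMul : Series3 F V →ₗ[F] Series3 F V where
  toFun P := ⟨fun m n p => P.1 m n (p - 1) - P.1 (m - 1) n p - P.1 m (n - 1) p, by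
    obtain ⟨N, hN⟩ := P.2
    refine ⟨N + 1, fun m n p h => ?_⟩
    beta_reduce
    rw [hN m n (p - 1) (by omega), hN (m - 1) n p (by omega), hN m (n - 1) p (by omega)]
    simp⟩
  map_add' P Q := by
    ext m n p
    simp only [Submodule.coe_add, Pi.add_apply]
    abel
  map_smul' c P := by
    ext m n p
    simp [smul_sub]

variable (F V)

/-- The space `V_{λ,μ} = V[[λ⁻¹, μ⁻¹, (λ + μ)⁻¹]][λ, μ]`, i.e. the quotient of
`V[[λ⁻¹, μ⁻¹, ν⁻¹]][λ, μ, ν]` by its submodule `(ν - λ - μ) V[[λ⁻¹, μ⁻¹, ν⁻¹]][λ, μ, ν]`. -/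
abbrev VLM : Type _ := Series3 F V ⧸ LinearMap.range (relMul (F := F) (V := V))

variable {F V}

/-- A way of turning a series in three variables into a family of coefficients given by binomial
sums, packaged as a linear map on `V_{λ,μ}`. -/
noncomputable def expansion (T : (ℤ → ℤ → ℤ → V) →ₗ[F] (ℤ → ℤ → ℤ → ℕ → V))
    (hT : ∀ P : Series3 F V, ∀ i j, BddFamily (T P.1 i j))
    (hrel : ∀ P : Series3 F V, ∀ i j, binomSum (T (relMul P).1 i j) = 0) :
    VLM F V →ₗ[F] (ℤ → ℤ → V) :=
  Submodule.liftQ _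
    { toFun := fun P i j => binomSum (T P.1 i j)
      map_add' := fun P Q => by
        ext i j
        rw [Submodule.coe_add, map_add]
        exact binomSum_add (hT P i j) (hT Q i j)
      map_smul' := fun c P => by
        ext i j
        rw [Submodule.coe_smul, map_smul]
        exact binomSum_smul c _ (hT P i j) }
    (by
      rintro _ ⟨P, rfl⟩
      rw [LinearMap.mem_ker]
      ext i j
      exact hrel P i j)

theorem expansion_mk (T : (ℤ → ℤ → ℤ → V) →ₗ[F] (ℤ → ℤ → ℤ → ℕ → V)) (hT) (hrel)
    (P : Series3 F V) (i j : ℤ) :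
    expansion T hT hrel (Submodule.Quotient.mk P) i j = binomSum (T P.1 i j) := rfl

/-- The embedding `ι_{μ,λ} : V_{λ,μ} → V((λ⁻¹))((μ⁻¹))`, which expands the powers of `ν = λ + μ`
in the domain `|μ| > |λ|`: `ν ^ p = ∑_k (p choose k) λ ^ k * μ ^ (p - k)`. An element of
`V((λ⁻¹))((μ⁻¹))` is given by its coefficients, `iotaML F V x i j` being the one of `λ ^ i * μ ^ j`. -/
noncomputable def iotaML (F V : Type*) [Field F] [AddCommGroup V] [Module F V] :
    VLM F V →ₗ[F] (ℤ → ℤ → V) :=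
  expansion
    { toFun := fun P i j p k => P (i - k) (j - p + k) p
      map_add' := fun _ _ => rfl
      map_smul' := fun _ _ => rfl }
    (fun P i j => by
      obtain ⟨N, hN⟩ := P.2
      refine ⟨N, j - N, fun p k h => ?_⟩
      by_contra hc
      exact h (hN _ _ _ (by omega)))
    (fun P i j => by
      have hb : BddFamily fun (p : ℤ) (k : ℕ) => P.1 (i - k) (j - 1 - p + k) p := by
        obtain ⟨N, hN⟩ := P.2
        refine ⟨N, j - 1 - N, fun p k h => ?_⟩
        by_contra hc
        exact h (hN _ _ _ (by omega))
      rw [← binomSum_pascal hb]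
      congr 1
      funext p k
      simp only [relMul, LinearMap.coe_mk, AddHom.coe_mk]
      push_cast
      rw [show j - 1 - (p - 1) + k = j - p + k by ring,
        show i - ((k : ℤ) + 1) = i - k - 1 by ring,
        show j - 1 - p + ((k : ℤ) + 1) = j - p + k by ring,
        show j - 1 - p + (k : ℤ) = j - p + k - 1 by ring])

/-- The embedding `ι_{λ,μ} : V_{λ,μ} → V((μ⁻¹))((λ⁻¹))`, which expands the powers of `ν = λ + μ`
in the domain `|λ| > |μ|`: `ν ^ p = ∑_k (p choose k) μ ^ k * λ ^ (p - k)`; here `iotaLM F V x i j` is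
the coefficient of `μ ^ i * λ ^ j`. -/
noncomputable def iotaLM (F V : Type*) [Field F] [AddCommGroup V] [Module F V] :
    VLM F V →ₗ[F] (ℤ → ℤ → V) :=
  expansion
    { toFun := fun P i j p k => P (j - p + k) (i - k) p
      map_add' := fun _ _ => rfl
      map_smul' := fun _ _ => rfl }
    (fun P i j => by
      obtain ⟨N, hN⟩ := P.2
      refine ⟨N, j - N, fun p k h => ?_⟩
      by_contra hc
      exact h (hN _ _ _ (by omega)))
    (fun P i j => by
      have hb : BddFamily fun (p : ℤ) (k : ℕ) => P.1 (j - 1 - p + k) (i - k) p := by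
        obtain ⟨N, hN⟩ := P.2
        refine ⟨N, j - 1 - N, fun p k h => ?_⟩
        by_contra hc
        exact h (hN _ _ _ (by omega))
      rw [← binomSum_pascal hb]
      congr 1
      funext p k
      simp only [relMul, LinearMap.coe_mk, AddHom.coe_mk]
      push_cast
      rw [show j - 1 - (p - 1) + k = j - p + k by ring,
        show i - ((k : ℤ) + 1) = i - k - 1 by ring,
        show j - 1 - p + ((k : ℤ) + 1) = j - p + k by ring,
        show j - 1 - p + (k : ℤ) = j - p + k - 1 by ring]
      abel)

/-- The embedding `ι_{λ,λ+μ} : V_{λ,μ} → V(((λ+μ)⁻¹))((λ⁻¹))`, which expands the powers of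
`μ = -λ + ν` in the domain `|λ| > |ν|`, where `ν = λ + μ`:
`μ ^ n = ∑_k (n choose k) ν ^ k * (-λ) ^ (n - k)`; here `iotaLN F V x i j` is the coefficient of
`ν ^ i * λ ^ j`. -/
noncomputable def iotaLN (F V : Type*) [Field F] [AddCommGroup V] [Module F V] :
    VLM F V →ₗ[F] (ℤ → ℤ → V) :=
  expansion
    { toFun := fun P i j n k => ((n - k).negOnePow : ℤ) • P (j - n + k) n (i - k)
      map_add' := fun _ _ => by
        ext
        simp only [Pi.add_apply, smul_add]
      map_smul' := fun c _ => by
        ext i j n k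
        simp only [Pi.smul_apply, RingHom.id_apply]
        exact smul_comm _ c _ }
    (fun P i j => by
      obtain ⟨N, hN⟩ := P.2
      refine ⟨N, j - N, fun p k h => ?_⟩
      by_contra hc
      refine h ?_
      simp only [LinearMap.coe_mk, AddHom.coe_mk]
      rw [hN _ _ _ (by omega), smul_zero])
    (fun P i j => by
      have hb : BddFamily fun (n : ℤ) (k : ℕ) =>
          ((n - k).negOnePow : ℤ) • P.1 (j - 1 - n + k) n (i - k) := by
        obtain ⟨N, hN⟩ := P.2
        refine ⟨N, j - 1 - N, fun p k h => ?_⟩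
        by_contra hc
        refine h ?_
        beta_reduce
        rw [hN _ _ _ (by omega), smul_zero]
      rw [← binomSum_pascal hb]
      congr 1
      funext n k
      simp only [relMul, LinearMap.coe_mk, AddHom.coe_mk]
      have s1 : ((n - 1 - k).negOnePow : ℤ) = -((n - k).negOnePow : ℤ) := by
        rw [show n - 1 - (k : ℤ) = n - k - 1 by ring, Int.negOnePow_sub, Int.negOnePow_one]
        simp
      push_cast
      rw [show n - ((k : ℤ) + 1) = n - 1 - k by ring, s1,
        show j - 1 - (n - 1) + k = j - n + k by ring,
        show i - ((k : ℤ) + 1) = i - k - 1 by ring,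
        show j - 1 - n + ((k : ℤ) + 1) = j - n + k by ring,
        show j - 1 - n + (k : ℤ) = j - n + k - 1 by ring]
      simp only [smul_sub, neg_smul]
      abel)

end TwoVariables

/-! ### Pseudodifferential operators -/

section PDO

variable {F : Type*} [Field F] {V : Type*} [CommRing V] [Algebra F V]

theorem comp_bdd (D : Derivation F V V) (A B : LaurentSeries V) (p : ℤ) :
    BddFamily fun n k => lc A n * (D.toLinearMap ^ k) (lc B (p - n + k)) := by
  obtain ⟨M, hM⟩ := exists_lc_bound A
  obtain ⟨N, hN⟩ := exists_lc_bound B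
  refine ⟨M, p - N, fun n k h => ?_⟩
  by_contra hc
  refine h ?_
  by_cases h1 : n ≤ M
  · beta_reduce
    rw [hN _ (by omega), map_zero, mul_zero]
  · beta_reduce
    rw [hM _ (by omega), zero_mul]

/-- For `A(λ) = ∑_n a_n λ ^ n` and `B(λ)` in `V((λ⁻¹))`, the series
`A(λ + ∂) B(λ) = ∑_n a_n (λ + ∂) ^ n B(λ)`, where `(λ + ∂) ^ n` is expanded in non-negative powers
of `∂`, which acts on the coefficients of `B`. The coefficient of `λ ^ p` is
`∑_{n, k} (n choose k) * a_n * ∂ ^ k b_{p - n + k}`. This is also the symbol of the product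
`A(∂) ∘ B(∂)` of the pseudodifferential operators in `V((∂⁻¹))` with symbols `A(λ)` and `B(λ)`. -/
noncomputable def comp (D : Derivation F V V) :
    LaurentSeries V →ₗ[F] LaurentSeries V →ₗ[F] LaurentSeries V :=
  LinearMap.mk₂ F
    (fun A B => mkSeries
      (fun p => binomSum fun n k => lc A n * (D.toLinearMap ^ k) (lc B (p - n + k)))
      (by
        obtain ⟨M, hM⟩ := exists_lc_bound A
        obtain ⟨N, hN⟩ := exists_lc_bound B
        refine ⟨M + N, fun p hp => binomSum_eq_zero fun n k => ?_⟩
        by_cases h1 : n ≤ M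
        · rw [hN _ (by omega), map_zero, mul_zero]
        · rw [hM _ (by omega), zero_mul]))
    (fun A A' B => lc_ext fun p => by
      have : ∀ C C' : LaurentSeries V, lc (C + C') p = lc C p + lc C' p := fun _ _ => rfl
      rw [this, lc_mkSeries, lc_mkSeries, lc_mkSeries,
        ← binomSum_add (comp_bdd D A B p) (comp_bdd D A' B p)]
      congr 1
      funext n k
      exact add_mul _ _ _)
    (fun c A B => lc_ext fun p => by
      have : ∀ C : LaurentSeries V, lc (c • C) p = c • lc C p := fun _ => rfl
      rw [this, lc_mkSeries, lc_mkSeries, ← binomSum_smul c _ (comp_bdd D A B p)]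
      congr 1
      funext n k
      exact smul_mul_assoc c _ _)
    (fun A B B' => lc_ext fun p => by
      have : ∀ C C' : LaurentSeries V, lc (C + C') p = lc C p + lc C' p := fun _ _ => rfl
      rw [this, lc_mkSeries, lc_mkSeries, lc_mkSeries,
        ← binomSum_add (comp_bdd D A B p) (comp_bdd D A B' p)]
      congr 1
      funext n k
      rw [← mul_add, ← map_add]
      rfl)
    (fun c A B => lc_ext fun p => by
      have : ∀ C : LaurentSeries V, lc (c • C) p = c • lc C p := fun _ => rfl
      rw [this, lc_mkSeries, lc_mkSeries, ← binomSum_smul c _ (comp_bdd D A B p)]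
      congr 1
      funext n k
      rw [← mul_smul_comm, ← map_smul]
      rfl)

theorem lc_comp (D : Derivation F V V) (A B : LaurentSeries V) (p : ℤ) :
    lc (comp D A B) p =
      binomSum fun n k => lc A n * (D.toLinearMap ^ k) (lc B (p - n + k)) := by
  unfold comp
  rw [LinearMap.mk₂_apply, lc_mkSeries]

/-- For `A(λ) = ∑_n a_n λ ^ n`, the series `A(-λ - ∂) = ∑_n (-λ - ∂) ^ n a_n`: the powers of
`-λ - ∂` are moved to the left and expanded in non-negative powers of `∂`, which acts on the
coefficients. The coefficient of `λ ^ p` is `∑_k (-1) ^ (p + k) * (p + k choose k) * ∂ ^ k a_{p + k}`. -/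
noncomputable def negShift (D : Derivation F V V) (A : LaurentSeries V) : LaurentSeries V :=
  mkSeries
    (fun p => ∑ᶠ k : ℕ, ((p + k).negOnePow : ℤ) •
      Ring.choose (p + k) k • (D.toLinearMap ^ k) (lc A (p + k)))
    (by
      obtain ⟨N, hN⟩ := exists_lc_bound A
      refine ⟨N, fun p hp => finsum_eq_zero_of_forall_eq_zero fun k => ?_⟩
      rw [hN _ (by omega), map_zero, smul_zero, smul_zero])

/-- The square matrices `C(∂)` and `K(∂)` of pseudodifferential operators, given by their symbols,
are inverse to each other: `C(∂) ∘ K(∂) = K(∂) ∘ C(∂) = 1`. -/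
def IsInverse (D : Derivation F V V) {m : ℕ} (C K : Matrix (Fin m) (Fin m) (LaurentSeries V)) :
    Prop :=
  (∀ α γ, ∑ β, comp D (C α β) (K β γ) = if α = γ then 1 else 0) ∧
    ∀ α γ, ∑ β, comp D (K α β) (C β γ) = if α = γ then 1 else 0

end PDO

/-! ### Non-local Poisson vertex algebras -/

section PVA

variable {F : Type*} [Field F] {V : Type*} [CommRing V] [Algebra F V]

/-- A bilinear map `{· _λ ·} : V × V → V((λ⁻¹))`. -/
abbrev LamBracket (F V : Type*) [Field F] [CommRing V] [Algebra F V] : Type _ :=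
  V →ₗ[F] V →ₗ[F] LaurentSeries V

/-- For a map `f : V → V((x⁻¹))` and `G = ∑_n g_n y ^ n` in `V((y⁻¹))`, the coefficient of
`x ^ i * y ^ j` in `f(G) = ∑_n f(g_n) y ^ n`. -/
def iterCoeff (f : V → LaurentSeries V) (G : LaurentSeries V) (i j : ℤ) : V :=
  lc (f (lc G j)) i

/-- `br` is a non-local PVA `λ`-bracket on the differential algebra `V` with derivation `D`. -/
structure IsPVA (D : Derivation F V V) (br : LamBracket F V) : Prop where
  /-- Sesquilinearity: `{∂a _λ b} = -λ {a _λ b}`. -/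
  sesqui_left : ∀ a b, br (D a) b = -lamMul (br a b)
  /-- Sesquilinearity: `{a _λ ∂b} = (λ + ∂) {a _λ b}`. -/
  sesqui_right : ∀ a b, br a (D b) = lamMul (br a b) + (br a b).map D
  /-- Left Leibniz rule: `{a _λ bc} = b {a _λ c} + c {a _λ b}`. -/
  leibniz_left : ∀ a b c, br a (b * c) = b • br a c + c • br a b
  /-- Right Leibniz rule: `{ab _λ c} = {a _{λ+∂} c}_→ b + {b _{λ+∂} c}_→ a`. -/
  leibniz_right : ∀ a b c, br (a * b) c =
    comp D (br a c) (HahnSeries.C b) + comp D (br b c) (HahnSeries.C a)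
  /-- Skewsymmetry: `{b _λ a} = -{a _{-λ-∂} b}`. -/
  skew : ∀ a b, br b a = -negShift D (br a b)
  /-- Admissibility: `{a _λ {b _μ c}}`, an element of `V((λ⁻¹))((μ⁻¹))`, is in the image of
  `V_{λ,μ}`. -/
  admissible : ∀ a b c, ∃ x : VLM F V, iotaML F V x = iterCoeff (br a) (br b c)
  /-- Jacobi identity: `{a _λ {b _μ c}} - {b _μ {a _λ c}} = {{a _λ b} _{λ+μ} c}` in `V_{λ,μ}`,
  where the three terms are identified with elements `x`, `y`, `z` of `V_{λ,μ}` through its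
  embeddings in `V((λ⁻¹))((μ⁻¹))`, `V((μ⁻¹))((λ⁻¹))` and `V(((λ+μ)⁻¹))((λ⁻¹))`. -/
  jacobi : ∀ a b c, ∃ x y z : VLM F V,
    iotaML F V x = iterCoeff (br a) (br b c) ∧
    iotaLM F V y = iterCoeff (br b) (br a c) ∧
    iotaLN F V z = iterCoeff (fun v => br v c) (br a b) ∧
    x - y = z

/-- Two PVA `λ`-brackets are compatible if all their linear combinations are PVA `λ`-brackets. -/
structure Compatible (D : Derivation F V V) (br₀ br₁ : LamBracket F V) : Prop where
  left : IsPVA D br₀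
  right : IsPVA D br₁
  comb : ∀ s t : F, IsPVA D (s • br₀ + t • br₁)

/-- The matrix `C` with entries `C_{αβ}(λ) = {θ_β _λ θ_α}`. -/
def constraintMatrix (br : LamBracket F V) {m : ℕ} (θ : Fin m → V) :
    Matrix (Fin m) (Fin m) (LaurentSeries V) :=
  Matrix.of fun α β => br (θ β) (θ α)

/-- The Dirac modification
`{a _λ b} - ∑_{α,β} {θ_β _{λ+∂} b}_→ K_{βα}(λ+∂) {a _λ θ_α}`
of a bracket; here `K` stands for the inverse of the matrix `C(∂)`. -/
noncomputable def diracModification (D : Derivation F V V) (br : LamBracket F V) {m : ℕ}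
    (θ : Fin m → V) (K : Matrix (Fin m) (Fin m) (LaurentSeries V)) : LamBracket F V :=
  LinearMap.mk₂ F
    (fun a b => br a b - ∑ α, ∑ β, comp D (br (θ β) b) (comp D (K β α) (br a (θ α))))
    (fun a a' b => by
      simp only [map_add, LinearMap.add_apply, Finset.sum_add_distrib]
      abel)
    (fun c a b => by
      simp only [map_smul, LinearMap.smul_apply, ← Finset.smul_sum, smul_sub])
    (fun a b b' => by
      simp only [map_add, LinearMap.add_apply, Finset.sum_add_distrib]
      abel)
    (fun c a b => by
      simp only [map_smul, LinearMap.smul_apply, ← Finset.smul_sum, smul_sub])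

/-- The ideal `I` is a differential ideal. -/
def IsDiffIdeal (D : Derivation F V V) (I : Ideal V) : Prop := ∀ a ∈ I, D a ∈ I

/-- `I` is a PVA ideal: a differential ideal such that `{I _λ V}` and `{V _λ I}` are contained in
`I((λ⁻¹))`. -/
structure IsPVAIdeal (D : Derivation F V V) (br : LamBracket F V) (I : Ideal V) : Prop where
  diff : IsDiffIdeal D I
  left : ∀ a ∈ I, ∀ b n, lc (br a b) n ∈ I
  right : ∀ a, ∀ b ∈ I, ∀ n, lc (br a b) n ∈ I

/-- The differential ideal generated by the elements `θ i`. -/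
def diffSpan (D : Derivation F V V) {m : ℕ} (θ : Fin m → V) : Ideal V :=
  sInf {I : Ideal V | IsDiffIdeal D I ∧ ∀ i, θ i ∈ I}

theorem diffSpan_isDiffIdeal (D : Derivation F V V) {m : ℕ} (θ : Fin m → V) :
    IsDiffIdeal D (diffSpan D θ) := by
  intro a ha
  simp only [diffSpan, Submodule.mem_sInf, Set.mem_ofPred_eq] at ha ⊢
  exact fun I hI => hI.1 a (ha I hI)

/-- The derivation induced on the quotient by a differential ideal. -/
noncomputable def quotientDerivation (D : Derivation F V V) (I : Ideal V) (hI : IsDiffIdeal D I) :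
    Derivation F (V ⧸ I) (V ⧸ I) :=
  Derivation.liftOfSurjective (f := Ideal.Quotient.mkₐ F I) (Ideal.Quotient.mkₐ_surjective F I)
    (d := D) (fun x hx => by
      rw [Ideal.Quotient.mkₐ_eq_mk, Ideal.Quotient.eq_zero_iff_mem] at hx ⊢
      exact hI x hx)

theorem quotientDerivation_mk (D : Derivation F V V) (I : Ideal V) (hI : IsDiffIdeal D I) (a : V) :
    quotientDerivation D I hI (Ideal.Quotient.mk I a) = Ideal.Quotient.mk I (D a) :=
  Derivation.liftOfSurjective_apply (f := Ideal.Quotient.mkₐ F I)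
    (Ideal.Quotient.mkₐ_surjective F I) (d := D) (fun x hx => by
      rw [Ideal.Quotient.mkₐ_eq_mk, Ideal.Quotient.eq_zero_iff_mem] at hx ⊢
      exact hI x hx) a

/-- The bracket `br'` on `V ⧸ I` is induced by the bracket `br` on `V`. -/
def IsInduced (I : Ideal V) (br : LamBracket F V) (br' : LamBracket F (V ⧸ I)) : Prop :=
  ∀ a b, br' (Ideal.Quotient.mk I a) (Ideal.Quotient.mk I b) =
    (br a b).map (Ideal.Quotient.mk I)

end PVA

end NonlocalPVA

namespace NonlocalPVA

/-! ### Coefficients and the degree filtration of `M((y⁻¹))` -/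

section Coefficients

variable {M M' : Type*} [AddCommGroup M] [AddCommGroup M']

/-! The heart of the matter is the Jacobi identity of the Dirac modification, which becomes
transparent in coordinates symmetric in the three arguments. Substituting ν = -λ₃ - ∂ (the operator
`adj₃`) turns the relation ν = λ + μ into λ₁ + λ₂ + λ₃ + ∂ = 0 (`adj₃_momentum`), and the three
embeddings of V_{λ,μ} are then expressed by one map `embed` after permutations of the variables
(`iotaML_adj₃`, `iotaLM_adj₃`, `iotaLN_adj₃`). By skewsymmetry {{a b} c} is, up to an adjoint, -{c
{a b}}, so all three Jacobi terms are iterated brackets of the same shape.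

Let U_a(β) = Σ_α K_{βα} ∘ {a θ_α} (`multiplier`). It solves C U_a = {a θ}, and {a b}^D = {a b} - Σ_β
{θ_β b} ∘ U_a(β) is a replacement made in the argument a. The key claim, `IsPVA.embed_proj`, is that
if w(a, b, c) lifts {a {b c}}, then {a {b c}^D}^D is lifted by making this replacement in a, b and c
together (`proj`), composing on the right with U in the corresponding variable. The Leibniz rule
(`IsPVA.bracket_comp`) produces the replacement in b and a term containing {a U_b}. Implicit
differentiation of C U_b = {b θ} expresses {a U_b} through K, and because K is skewadjoint
(`IsPVA.negShift_inverse`) that term is exactly the replacement in c. Since `proj` is additive,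
commutes with λ₁ + λ₂ + λ₃ + ∂ and respects permutations, it carries the Jacobi identity of a
bracket to that of its modification, and admissibility comes along.

For t ≠ 0, centrality of the θ_i for the first bracket makes s{ }₀ + t{ }₁^D the Dirac modification
of s{ }₀ + t{ }₁, whose constraint matrix is tC; this gives compatibility. The θ_i are central for
the modified bracket as well, and a differential ideal generated by central elements is a PVA ideal,
so both brackets descend to the quotient.

Most of the formal identities are instances of facts about one product, `star`, attached to a
biadditive map and an endomorphism. They are checked on monomials and extended by bounds on degrees.
-/

@[simp] theorem lc_zero (n : ℤ) : lc (0 : LaurentSeries M) n = 0 := rfl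

@[simp] theorem lc_add (A B : LaurentSeries M) (n : ℤ) : lc (A + B) n = lc A n + lc B n := rfl

@[simp] theorem lc_neg (A : LaurentSeries M) (n : ℤ) : lc (-A) n = -lc A n := rfl

@[simp] theorem lc_sub (A B : LaurentSeries M) (n : ℤ) : lc (A - B) n = lc A n - lc B n := by
  rw [sub_eq_add_neg, lc_add, lc_neg, ← sub_eq_add_neg]

/-- The coefficient of `y ^ n` as an additive map. -/
def lcHom (n : ℤ) : LaurentSeries M →+ M where
  toFun A := lc A n
  map_zero' := rfl
  map_add' _ _ := rfl

@[simp] theorem lcHom_apply (n : ℤ) (A : LaurentSeries M) : lcHom n A = lc A n := rfl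

theorem lc_sum {ι : Type*} (s : Finset ι) (f : ι → LaurentSeries M) (n : ℤ) :
    lc (∑ i ∈ s, f i) n = ∑ i ∈ s, lc (f i) n :=
  map_sum (lcHom n) f s

/-- The additive map induced by `f` on the coefficients. -/
noncomputable def mapHom (f : M →+ M') : LaurentSeries M →+ LaurentSeries M' where
  toFun A := A.map f
  map_zero' := lc_ext fun n => by simp [lc]
  map_add' A B := lc_ext fun n => by simp [lc]

@[simp] theorem lc_mapHom (f : M →+ M') (A : LaurentSeries M) (n : ℤ) :
    lc (mapHom f A) n = f (lc A n) := rfl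

/-- The monomial `a * y ^ n`. -/
noncomputable def mono (n : ℤ) (a : M) : LaurentSeries M := HahnSeries.single (-n) a

theorem lc_mono (n p : ℤ) (a : M) : lc (mono n a) p = if p = n then a else 0 := by
  unfold lc mono
  rw [HahnSeries.coeff_single]
  simp [neg_inj]

@[simp] theorem lc_mono_same (n : ℤ) (a : M) : lc (mono n a) n = a := by simp [lc_mono]

theorem lc_mono_of_ne {n p : ℤ} (h : p ≠ n) (a : M) : lc (mono n a) p = 0 := by simp [lc_mono, h]

@[simp] theorem mapHom_mono (f : M →+ M') (n : ℤ) (a : M) :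
    mapHom f (mono n a) = mono n (f a) := lc_ext fun p => by
  rw [lc_mapHom, lc_mono, lc_mono]
  split_ifs <;> simp

/-- The degree of `A` is at most `N`. -/
def DegLE (A : LaurentSeries M) (N : ℤ) : Prop := ∀ n, N < n → lc A n = 0

theorem exists_degLE (A : LaurentSeries M) : ∃ N, DegLE A N := exists_lc_bound A

theorem DegLE.mono' {A : LaurentSeries M} {N N' : ℤ} (h : DegLE A N) (hN : N ≤ N') : DegLE A N' :=
  fun n hn => h n (by omega)

theorem degLE_mono (n : ℤ) (a : M) : DegLE (mono n a) n := fun p hp => by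
  rw [lc_mono_of_ne (by omega)]

/-- Two additive maps agree if they agree on monomials and on series of low degree. -/
theorem hom_ext_of_low {Φ Ψ : LaurentSeries M →+ M'} (hm : ∀ n a, Φ (mono n a) = Ψ (mono n a))
    (N : ℤ) (hlow : ∀ A, DegLE A N → Φ A = Ψ A) : Φ = Ψ := by
  -- Finitely many leading monomials are peeled off, and the remaining tail falls under `hlow`; no
  -- continuity is needed.
  have key : ∀ k : ℕ, ∀ A, DegLE A (N + k) → Φ A = Ψ A := by
    intro k
    induction k with
    | zero => intro A hA; exact hlow A (by simpa using hA)
    | succ k ih =>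
      intro A hA
      have h1 : DegLE (A - mono (N + k + 1) (lc A (N + k + 1))) (N + k) := by
        intro n hn
        rw [lc_sub]
        by_cases h : n = N + k + 1
        · subst h; simp
        · rw [lc_mono_of_ne h, hA n (by push_cast; omega), sub_zero]
      have h2 := ih _ h1
      rw [map_sub, map_sub, hm] at h2
      exact sub_left_injective h2
  ext A
  obtain ⟨M', hA⟩ := exists_degLE A
  exact key (M' - N).toNat A (hA.mono' (by omega))

/-- Two additive maps of bounded degree agree if they agree on monomials. -/
theorem hom_ext_of_deg {Φ Ψ : LaurentSeries M →+ LaurentSeries M'}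
    (hm : ∀ n a, Φ (mono n a) = Ψ (mono n a)) (c : ℤ)
    (hΦ : ∀ A N, DegLE A N → DegLE (Φ A) (N + c))
    (hΨ : ∀ A N, DegLE A N → DegLE (Ψ A) (N + c)) : Φ = Ψ := by
  ext A : 1
  refine lc_ext fun p => ?_
  -- Series of degree at most p - c - 1 have images without a coefficient at y ^ p, so both sides
  -- vanish on them.
  have := hom_ext_of_low (Φ := (lcHom p).comp Φ) (Ψ := (lcHom p).comp Ψ)
    (fun n a => by simp [hm]) (p - c - 1) (fun A hA => by
      simp only [AddMonoidHom.comp_apply, lcHom_apply]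
      rw [hΦ A _ hA p (by omega), hΨ A _ hA p (by omega)])
  exact DFunLike.congr_fun this A

/-- Multiplication by `y ^ n`. -/
noncomputable def shift (n : ℤ) : LaurentSeries M →+ LaurentSeries M where
  toFun A := mkSeries (fun p => lc A (p - n)) (by
    obtain ⟨N, hN⟩ := exists_lc_bound A
    exact ⟨N + n, fun p hp => hN _ (by omega)⟩)
  map_zero' := lc_ext fun p => by rw [lc_mkSeries]; rfl
  map_add' A B := lc_ext fun p => by rw [lc_add]; simp only [lc_mkSeries, lc_add]

@[simp] theorem lc_shift (n : ℤ) (A : LaurentSeries M) (p : ℤ) :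
    lc (shift n A) p = lc A (p - n) := by
  simp only [shift, AddMonoidHom.coe_mk, ZeroHom.coe_mk, lc_mkSeries]

theorem DegLE.shift {A : LaurentSeries M} {N : ℤ} (h : DegLE A N) (n : ℤ) :
    DegLE (shift n A) (N + n) := fun p hp => by rw [lc_shift, h _ (by omega)]

@[simp] theorem shift_mono (n m : ℤ) (a : M) : shift n (mono m a) = mono (m + n) a :=
  lc_ext fun p => by simp [lc_mono, sub_eq_iff_eq_add]

theorem shift_shift (n m : ℤ) (A : LaurentSeries M) : shift n (shift m A) = shift (m + n) A :=
  lc_ext fun p => by simp only [lc_shift]; congr 1; ring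

theorem shift_zero (A : LaurentSeries M) : shift 0 A = A := lc_ext fun p => by simp

theorem DegLE.mapHom {A : LaurentSeries M} {N : ℤ} (h : DegLE A N) (f : M →+ M') :
    DegLE (mapHom f A) N := fun n hn => by rw [lc_mapHom, h n hn, map_zero]

end Coefficients

/-! ### The operators `y + T` and their powers -/

section Powers

variable {M M' : Type*} [AddCommGroup M] [AddCommGroup M']

theorem iterate_add (T : M →+ M) (k : ℕ) (a b : M) : T^[k] (a + b) = T^[k] a + T^[k] b :=
  iterate_map_add T k a b

theorem iterate_zero' (T : M →+ M) (k : ℕ) : T^[k] 0 = 0 := iterate_map_zero T k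

theorem powT_support {B : LaurentSeries M} {N : ℤ} (hB : DegLE B N) (T : M →+ M) (n p : ℤ) (k : ℕ)
    (hk : N + n - p < k) : T^[k] (lc B (p - n + k)) = 0 := by
  rw [hB _ (by omega), iterate_zero']

/-- The operator `(y + T) ^ n` on `M((y⁻¹))`, expanded in non-negative powers of `T`. -/
noncomputable def powT (T : M →+ M) (n : ℤ) : LaurentSeries M →+ LaurentSeries M where
  toFun B := mkSeries (fun p => ∑ᶠ k : ℕ, Ring.choose n k • T^[k] (lc B (p - n + k))) (by
    obtain ⟨N, hN⟩ := exists_degLE B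
    refine ⟨N + n, fun p hp => finsum_eq_zero_of_forall_eq_zero fun k => ?_⟩
    rw [powT_support hN T n p k (by omega), smul_zero])
  map_zero' := lc_ext fun p => by
    rw [lc_mkSeries]
    exact finsum_eq_zero_of_forall_eq_zero fun k => by simp
  map_add' A B := lc_ext fun p => by
    simp only [lc_add, lc_mkSeries]
    have fin : ∀ B : LaurentSeries M,
        (Function.support fun k : ℕ => Ring.choose n k • T^[k] (lc B (p - n + k))).Finite := by
      intro B
      obtain ⟨N, hN⟩ := exists_degLE B
      refine (Set.finite_Iic (N + n - p).toNat).subset fun k hk => ?_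
      by_contra h
      simp only [Set.mem_Iic, not_le] at h
      exact hk (by
        show _ • _ = _
        rw [powT_support hN T n p k (by omega), smul_zero])
    rw [← finsum_add_distrib (fin A) (fin B)]
    simp only [iterate_add, smul_add]

theorem lc_powT (T : M →+ M) (n : ℤ) (B : LaurentSeries M) (p : ℤ) :
    lc (powT T n B) p = ∑ᶠ k : ℕ, Ring.choose n k • T^[k] (lc B (p - n + k)) := by
  simp only [powT, AddMonoidHom.coe_mk, ZeroHom.coe_mk, lc_mkSeries]

theorem lc_powT_eq_sum (T : M →+ M) (n : ℤ) {B : LaurentSeries M} {N : ℤ} (hB : DegLE B N) (p : ℤ)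
    (K : ℕ) (hK : N + n - p < K) :
    lc (powT T n B) p = ∑ k ∈ Finset.range K, Ring.choose n k • T^[k] (lc B (p - n + k)) := by
  rw [lc_powT]
  refine finsum_eq_sum_of_support_subset _ fun k hk => ?_
  by_contra h
  simp only [Finset.coe_range, Set.mem_Iio, not_lt] at h
  exact hk (by
    show _ • _ = _
    rw [powT_support hB T n p k (by omega), smul_zero])

theorem DegLE.powT {B : LaurentSeries M} {N : ℤ} (hB : DegLE B N) (T : M →+ M) (n : ℤ) :
    DegLE (powT T n B) (N + n) := fun p hp => by
  rw [lc_powT_eq_sum T n hB p 0 (by simpa using hp)]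
  simp

/-- The operator `y + T`. -/
noncomputable def del (T : M →+ M) : LaurentSeries M →+ LaurentSeries M := shift 1 + mapHom T

@[simp] theorem lc_del (T : M →+ M) (B : LaurentSeries M) (p : ℤ) :
    lc (del T B) p = lc B (p - 1) + T (lc B p) := by
  simp [del]

theorem del_apply (T : M →+ M) (B : LaurentSeries M) : del T B = shift 1 B + mapHom T B := rfl

theorem DegLE.del {B : LaurentSeries M} {N : ℤ} (hB : DegLE B N) (T : M →+ M) :
    DegLE (del T B) (N + 1) := fun p hp => by
  rw [lc_del, hB _ (by omega), hB _ (by omega), map_zero, add_zero]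

theorem del_mono (T : M →+ M) (n : ℤ) (a : M) : del T (mono n a) = mono (n + 1) a + mono n (T a) := by
  simp [del_apply]

/-- Pascal's rule for binomial coefficients with integer upper index. -/
theorem powT_succ (T : M →+ M) (n : ℤ) (B : LaurentSeries M) :
    powT T (n + 1) B = del T (powT T n B) := by
  obtain ⟨N, hN⟩ := exists_degLE B
  refine lc_ext fun p => ?_
  -- This truncates all three sums at once; the sum to which T is applied is one term shorter
  -- because T raises the summation index by one.
  set K := (N + n - p + 1).toNat with hK
  rw [lc_del, lc_powT_eq_sum T (n + 1) hN p (K + 1) (by omega),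
    lc_powT_eq_sum T n hN (p - 1) (K + 1) (by omega), lc_powT_eq_sum T n hN p K (by omega),
    Finset.sum_range_succ', Finset.sum_range_succ', map_sum]
  simp only [Ring.choose_zero_right, Nat.cast_zero, one_smul, Function.iterate_zero, id_eq,
    map_zsmul, ← Function.iterate_succ_apply' (f := T), Ring.choose_succ_succ, add_smul,
    Finset.sum_add_distrib]
  have e : ∀ k : ℕ, p - (n + 1) + ((k + 1 : ℕ) : ℤ) = p - n + k := by intro k; push_cast; ring
  have e' : ∀ k : ℕ, p - 1 - n + ((k + 1 : ℕ) : ℤ) = p - n + k := by intro k; push_cast; ring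
  simp only [e, e', show p - (n + 1) + 0 = p - 1 - n + 0 by ring]
  abel

@[simp] theorem powT_zero (T : M →+ M) (B : LaurentSeries M) : powT T 0 B = B := lc_ext fun p => by
  rw [lc_powT, finsum_eq_single _ 0]
  · simp
  · intro k hk
    obtain ⟨k, rfl⟩ := Nat.exists_eq_succ_of_ne_zero hk
    simp [Ring.choose_zero_succ]

/-- The leading coefficient of (y + T) B is that of B, so a kernel element has no leading
coefficient. Injectivity is what carries statements about integer powers of y + T down to negative
exponents. -/
theorem del_injective (T : M →+ M) : Function.Injective (del T) := by
  rw [injective_iff_map_eq_zero]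
  intro B hB
  obtain ⟨N, hN⟩ := exists_degLE B
  have key : ∀ k : ℕ, DegLE B (N - k) := by
    intro k
    induction k with
    | zero => simpa using hN
    | succ k ih =>
      intro n hn
      have h := congrArg (fun A => lc A (n + 1)) hB
      simp only [lc_del, lc_zero, add_sub_cancel_right] at h
      rwa [ih (n + 1) (by push_cast at hn; omega), map_zero, add_zero] at h
  exact lc_ext fun n => key (N - n + 1).toNat n (by omega)

/-- A map that intertwines `y + T` with `y + T'` intertwines all their powers. -/
theorem powT_intertwine (T : M →+ M) (T' : M' →+ M') (f : LaurentSeries M → LaurentSeries M')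
    (h : ∀ B, f (del T B) = del T' (f B)) (n : ℤ) (B : LaurentSeries M) :
    f (powT T n B) = powT T' n (f B) := by
  induction n using Int.induction_on with
  | zero => simp
  | succ n ih => rw [powT_succ, powT_succ, h, ih]
  | pred n ih =>
    apply del_injective T'
    rw [← h, ← powT_succ, ← powT_succ, sub_add_cancel, ih]

theorem powT_add (T : M →+ M) (m n : ℤ) (B : LaurentSeries M) :
    powT T (m + n) B = powT T m (powT T n B) := by
  induction m using Int.induction_on with
  | zero => simp
  | succ m ih => rw [show (m : ℤ) + 1 + n = m + n + 1 by ring, powT_succ, powT_succ, ih]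
  | pred m ih =>
    apply del_injective T
    rw [← powT_succ, ← powT_succ, show -(m : ℤ) - 1 + n + 1 = -m + n by ring, sub_add_cancel, ih]

theorem powT_mono_of_eq_zero (T : M →+ M) (n : ℤ) {a : M} (ha : T a = 0) (m : ℤ) :
    powT T n (mono m a) = mono (m + n) a := by
  induction n using Int.induction_on with
  | zero => simp
  | succ n ih => rw [powT_succ, ih, del_mono, ha]; simp [mono, add_assoc]
  | pred n ih =>
    apply del_injective T
    rw [← powT_succ, sub_add_cancel, ih, del_mono, ha]
    simp only [mono, HahnSeries.single_eq_zero, add_zero]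
    congr 2
    ring

end Powers

/-! ### Star products -/

section Star

variable {M₁ M₂ M₃ M₁₂ M₂₃ M N₁ N₂ N₃ : Type*} [AddCommGroup M₁] [AddCommGroup M₂]
  [AddCommGroup M₃] [AddCommGroup M₁₂] [AddCommGroup M₂₃] [AddCommGroup M] [AddCommGroup N₁]
  [AddCommGroup N₂] [AddCommGroup N₃]

theorem star_bddFamily (β : M₁ →+ M₂ →+ M₃) (T : M₂ →+ M₂) (A : LaurentSeries M₁)
    (B : LaurentSeries M₂) (p : ℤ) :
    BddFamily fun n k => β (lc A n) (T^[k] (lc B (p - n + k))) := by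
  obtain ⟨M, hM⟩ := exists_degLE A
  obtain ⟨N, hN⟩ := exists_degLE B
  refine ⟨M, p - N, fun n k h => ?_⟩
  by_contra hc
  refine h ?_
  by_cases h1 : n ≤ M
  · beta_reduce
    rw [hN _ (by omega), iterate_zero', map_zero]
  · beta_reduce
    rw [hM _ (by omega), map_zero, AddMonoidHom.zero_apply]

theorem star_bound (β : M₁ →+ M₂ →+ M₃) (T : M₂ →+ M₂) {A : LaurentSeries M₁}
    {B : LaurentSeries M₂} {M N : ℤ} (hM : DegLE A M) (hN : DegLE B N) (p : ℤ) (hp : M + N < p) :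
    binomSum (fun n k => β (lc A n) (T^[k] (lc B (p - n + k)))) = 0 := by
  refine binomSum_eq_zero fun n k => ?_
  by_cases h1 : n ≤ M
  · rw [hN _ (by omega), iterate_zero', map_zero]
  · rw [hM _ (by omega), map_zero, AddMonoidHom.zero_apply]

/-- The product `∑ β(a_n, (y + T) ^ n B)` of `A = ∑ a_n y ^ n` and `B` that comes from a biadditive
map `β` and an additive endomorphism `T`. -/
noncomputable def star (β : M₁ →+ M₂ →+ M₃) (T : M₂ →+ M₂) :
    LaurentSeries M₁ →+ LaurentSeries M₂ →+ LaurentSeries M₃ :=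
  AddMonoidHom.mk'
    (fun A => AddMonoidHom.mk'
      (fun B => mkSeries
        (fun p => binomSum fun n k => β (lc A n) (T^[k] (lc B (p - n + k))))
        (by
          obtain ⟨M, hM⟩ := exists_degLE A
          obtain ⟨N, hN⟩ := exists_degLE B
          exact ⟨M + N, star_bound β T hM hN⟩))
      (fun B B' => lc_ext fun p => by
        simp only [lc_add, lc_mkSeries]
        rw [← binomSum_add (star_bddFamily β T A B p) (star_bddFamily β T A B' p)]
        simp only [iterate_add, map_add]))
    (fun A A' => by
      ext B : 1
      refine lc_ext fun p => ?_
      simp only [AddMonoidHom.add_apply, AddMonoidHom.mk'_apply, lc_add, lc_mkSeries]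
      rw [← binomSum_add (star_bddFamily β T A B p) (star_bddFamily β T A' B p)]
      simp only [map_add, AddMonoidHom.add_apply])

theorem lc_star (β : M₁ →+ M₂ →+ M₃) (T : M₂ →+ M₂) (A : LaurentSeries M₁) (B : LaurentSeries M₂)
    (p : ℤ) : lc (star β T A B) p =
      binomSum fun n k => β (lc A n) (T^[k] (lc B (p - n + k))) := by
  simp only [star, AddMonoidHom.mk'_apply, lc_mkSeries]

theorem DegLE.star {A : LaurentSeries M₁} {B : LaurentSeries M₂} {m n : ℤ} (hA : DegLE A m)
    (hB : DegLE B n) (β : M₁ →+ M₂ →+ M₃) (T : M₂ →+ M₂) : DegLE (star β T A B) (m + n) :=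
  fun p hp => by rw [lc_star, star_bound β T hA hB p hp]

theorem binomSum_of_single (n : ℤ) {S : ℤ → ℕ → M} (h : ∀ m k, m ≠ n → S m k = 0) :
    binomSum S = ∑ᶠ k : ℕ, Ring.choose n k • S n k := by
  have hinj : Function.Injective fun k : ℕ => (n, k) := fun a b hab => by simpa using hab
  unfold binomSum
  rw [← finsum_mem_univ (f := fun x : ℤ × ℕ => Ring.choose x.1 x.2 • S x.1 x.2)]
  rw [← finsum_mem_range (f := fun x : ℤ × ℕ => Ring.choose x.1 x.2 • S x.1 x.2) hinj]
  refine finsum_mem_inter_support_eq' _ _ _ fun x hx => ?_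
  simp only [Set.mem_univ, Set.mem_range, true_iff]
  rcases x with ⟨m, k⟩
  by_cases hm : m = n
  · exact ⟨k, by rw [hm]⟩
  · exact absurd (by show _ • S m k = 0; rw [h m k hm, smul_zero]) hx

theorem map_finsum_of_powT (f : M →+ N₁) (T : M →+ M) (n : ℤ) (B : LaurentSeries M) (p : ℤ) :
    f (∑ᶠ k : ℕ, Ring.choose n k • T^[k] (lc B (p - n + k))) =
      ∑ᶠ k : ℕ, Ring.choose n k • f (T^[k] (lc B (p - n + k))) := by
  obtain ⟨N, hN⟩ := exists_degLE B
  rw [AddMonoidHom.map_finsum]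
  · simp only [map_zsmul]
  · refine (Set.finite_Iic (N + n - p).toNat).subset fun k hk => ?_
    by_contra h
    simp only [Set.mem_Iic, not_le] at h
    exact hk (by
      show _ • _ = _
      rw [powT_support hN T n p k (by omega), smul_zero])

/-- The base case to which identities for `star` are reduced: a monomial on the left acts by a power
of y + T. -/
theorem star_mono_left (β : M₁ →+ M₂ →+ M₃) (T : M₂ →+ M₂) (n : ℤ) (a : M₁)
    (B : LaurentSeries M₂) : star β T (mono n a) B = mapHom (β a) (powT T n B) :=
  lc_ext fun p => by
    rw [lc_star, binomSum_of_single n, lc_mapHom, lc_powT, map_finsum_of_powT]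
    · simp
    · intro m k hm
      rw [lc_mono_of_ne hm, map_zero, AddMonoidHom.zero_apply]

theorem mapHom_del (f : M →+ N₁) (T : M →+ M) (T' : N₁ →+ N₁) (h : ∀ a, f (T a) = T' (f a))
    (B : LaurentSeries M) : mapHom f (del T B) = del T' (mapHom f B) :=
  lc_ext fun p => by simp [h]

theorem mapHom_powT (f : M →+ N₁) (T : M →+ M) (T' : N₁ →+ N₁) (h : ∀ a, f (T a) = T' (f a))
    (n : ℤ) (B : LaurentSeries M) : mapHom f (powT T n B) = powT T' n (mapHom f B) :=
  powT_intertwine T T' _ (mapHom_del f T T' h) n B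

/-- Both sides raise the degree in A boundedly, so A may be a monomial; then it suffices that f₂
intertwines the powers of y + T and y + T'. -/
theorem star_natural {β : M₁ →+ M₂ →+ M₃} {T : M₂ →+ M₂} {β' : N₁ →+ N₂ →+ N₃} {T' : N₂ →+ N₂}
    (f₁ : M₁ →+ N₁) (f₂ : M₂ →+ N₂) (f₃ : M₃ →+ N₃) (h : ∀ a b, f₃ (β a b) = β' (f₁ a) (f₂ b))
    (hT : ∀ b, f₂ (T b) = T' (f₂ b)) (A : LaurentSeries M₁) (B : LaurentSeries M₂) :
    mapHom f₃ (star β T A B) = star β' T' (mapHom f₁ A) (mapHom f₂ B) := by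
  obtain ⟨b, hb⟩ := exists_degLE B
  refine DFunLike.congr_fun (hom_ext_of_deg (Φ := (mapHom f₃).comp ((star β T).flip B))
    (Ψ := ((star β' T').flip (mapHom f₂ B)).comp (mapHom f₁)) (fun n a => ?_) b
    (fun A N hA => (hA.star hb β T).mapHom f₃)
    (fun A N hA => (hA.mapHom f₁).star (hb.mapHom f₂) β' T')) A
  simp only [AddMonoidHom.comp_apply, AddMonoidHom.flip_apply, mapHom_mono, star_mono_left]
  rw [← mapHom_powT f₂ T T' hT]
  exact lc_ext fun p => by simp [h]

/-- The Leibniz rule `h` lets y + T pass to the left factor. On a y ^ n it yields one term with T₁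
a, and one in which T₂ joins y to form (y + T₂) ^ (n + 1). -/
theorem star_del {β : M₁ →+ M₂ →+ M} {T₁ : M₁ →+ M₁} {T₂ : M₂ →+ M₂} {T : M →+ M}
    (h : ∀ a b, T (β a b) = β (T₁ a) b + β a (T₂ b)) (A : LaurentSeries M₁)
    (B : LaurentSeries M₂) : star β T₂ (del T₁ A) B = del T (star β T₂ A B) := by
  obtain ⟨b, hb⟩ := exists_degLE B
  refine DFunLike.congr_fun (hom_ext_of_deg (Φ := ((star β T₂).flip B).comp (del T₁))
    (Ψ := (del T).comp ((star β T₂).flip B)) (fun n a => ?_) (1 + b)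
    (fun A N hA => by
      rw [← add_assoc]
      exact (hA.del T₁).star hb β T₂)
    (fun A N hA => by
      rw [add_comm 1 b, ← add_assoc]
      exact (hA.star hb β T₂).del T)) A
  simp only [AddMonoidHom.comp_apply, AddMonoidHom.flip_apply, del_mono, map_add,
    star_mono_left, powT_succ]
  exact lc_ext fun p => by simp [h]; abel

theorem star_powT {β : M₁ →+ M₂ →+ M} {T₁ : M₁ →+ M₁} {T₂ : M₂ →+ M₂} {T : M →+ M}
    (h : ∀ a b, T (β a b) = β (T₁ a) b + β a (T₂ b)) (n : ℤ) (A : LaurentSeries M₁)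
    (B : LaurentSeries M₂) : star β T₂ (powT T₁ n A) B = powT T n (star β T₂ A B) :=
  powT_intertwine T₁ T (fun A => star β T₂ A B) (fun A => star_del h A B) n A

theorem star_shift_left (β : M₁ →+ M₂ →+ M₃) (T : M₂ →+ M₂) (n : ℤ) (A : LaurentSeries M₁)
    (B : LaurentSeries M₂) : star β T (shift n A) B = star β T A (powT T n B) := by
  obtain ⟨b, hb⟩ := exists_degLE B
  refine DFunLike.congr_fun (hom_ext_of_deg (Φ := ((star β T).flip B).comp (shift n))
    (Ψ := (star β T).flip (powT T n B)) (fun m a => ?_) (b + n)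
    (fun A N hA => by
      rw [add_comm b n, ← add_assoc]
      exact (hA.shift n).star hb β T)
    (fun A N hA => hA.star (hb.powT T n) β T)) A
  simp only [AddMonoidHom.comp_apply, AddMonoidHom.flip_apply, shift_mono, star_mono_left, powT_add]

theorem shift_del (T : M →+ M) (n : ℤ) (B : LaurentSeries M) :
    shift n (del T B) = del T (shift n B) := lc_ext fun p => by
  simp only [lc_shift, lc_del]
  congr 2
  ring

theorem star_shift_right (β : M₁ →+ M₂ →+ M₃) (T : M₂ →+ M₂) (n : ℤ) (A : LaurentSeries M₁)
    (B : LaurentSeries M₂) : star β T A (shift n B) = shift n (star β T A B) := by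
  obtain ⟨b, hb⟩ := exists_degLE B
  refine DFunLike.congr_fun (hom_ext_of_deg (Φ := (star β T).flip (shift n B))
    (Ψ := (shift n).comp ((star β T).flip B)) (fun m a => ?_) (b + n)
    (fun A N hA => hA.star (hb.shift n) β T)
    (fun A N hA => by
      rw [← add_assoc]
      exact (hA.star hb β T).shift n)) A
  simp only [AddMonoidHom.comp_apply, AddMonoidHom.flip_apply, star_mono_left]
  rw [← powT_intertwine T T (shift n) (shift_del T n)]
  exact lc_ext fun p => by simp

/-- Four biadditive maps are allowed so that one statement covers associativity of `comp`, the
module law `actXY_comp` and the commutation `rightY_actXY`. For a monomial a y ^ n it follows from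
`star_powT` and naturality with respect to a. -/
theorem star_assoc {β : M₁ →+ M₂ →+ M₁₂} {γ : M₁₂ →+ M₃ →+ M} {β' : M₂ →+ M₃ →+ M₂₃}
    {γ' : M₁ →+ M₂₃ →+ M} {T₂ : M₂ →+ M₂} {T₃ : M₃ →+ M₃} {T : M₂₃ →+ M₂₃}
    (hT : ∀ b c, T (β' b c) = β' (T₂ b) c + β' b (T₃ c))
    (h : ∀ a b c, γ (β a b) c = γ' a (β' b c)) (A : LaurentSeries M₁) (B : LaurentSeries M₂)
    (C : LaurentSeries M₃) :
    star γ T₃ (star β T₂ A B) C = star γ' T A (star β' T₃ B C) := by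
  obtain ⟨b, hb⟩ := exists_degLE B
  obtain ⟨c, hc⟩ := exists_degLE C
  refine DFunLike.congr_fun (hom_ext_of_deg
    (Φ := ((star γ T₃).flip C).comp ((star β T₂).flip B))
    (Ψ := (star γ' T).flip (star β' T₃ B C)) (fun n a => ?_) (b + c)
    (fun A N hA => by
      rw [← add_assoc]
      exact (hA.star hb β T₂).star hc γ T₃)
    (fun A N hA => hA.star (hb.star hc β' T₃) γ' T)) A
  simp only [AddMonoidHom.comp_apply, AddMonoidHom.flip_apply, star_mono_left]
  rw [← star_powT hT]
  have := star_natural (β := β') (T := T₃) (β' := γ) (T' := T₃) (β a) (AddMonoidHom.id M₃) (γ' a)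
    (fun b c => (h a b c).symm) (fun _ => rfl) (powT T₂ n B) C
  rw [this]
  rfl

end Star

/-! ### Formal adjoints -/

section Adjoint

variable {M₁ M₂ M M' : Type*} [AddCommGroup M₁] [AddCommGroup M₂] [AddCommGroup M] [AddCommGroup M']

/-- The sign `(-1) ^ n`, as an integer. -/
def sgn (n : ℤ) : ℤ := (n.negOnePow : ℤ)

@[simp] theorem sgn_zero : sgn 0 = 1 := by simp [sgn]

theorem sgn_succ (n : ℤ) : sgn (n + 1) = -sgn n := by simp [sgn, Int.negOnePow_succ]

theorem sgn_mul_self (n : ℤ) : sgn n * sgn n = 1 := by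
  rw [sgn, ← Units.val_mul, ← Int.negOnePow_add, Int.negOnePow_even _ ⟨n, rfl⟩, Units.val_one]

theorem sgn_eq (n : ℤ) : sgn n = 1 ∨ sgn n = -1 := by
  rcases Int.units_eq_one_or n.negOnePow with h | h <;> simp [sgn, h]

theorem sgn_smul_finsum {ι : Type*} (n : ℤ) (f : ι → M) :
    sgn n • ∑ᶠ i, f i = ∑ᶠ i, sgn n • f i := by
  rcases sgn_eq n with h | h <;> simp [h, finsum_neg_distrib]

theorem adj_support {A : LaurentSeries M} {N : ℤ} (hA : DegLE A N) (T : M →+ M) (p : ℤ) (k : ℕ)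
    (hk : N - p < k) : T^[k] (lc A (p + k)) = 0 := by
  rw [hA _ (by omega), iterate_zero']

theorem adj_finite (T : M →+ M) (p : ℤ) (A : LaurentSeries M) : (Function.support fun k : ℕ =>
    sgn (p + k) • Ring.choose (p + k) k • T^[k] (lc A (p + k))).Finite := by
  obtain ⟨N, hN⟩ := exists_degLE A
  refine (Set.finite_Iic (N - p).toNat).subset fun k hk => ?_
  by_contra h
  simp only [Set.mem_Iic, not_le] at h
  exact hk (by
    show _ • _ = _
    rw [adj_support hN T p k (by omega), smul_zero, smul_zero])

/-- The adjoint `∑ (-y - T) ^ n a_n` of `∑ a_n y ^ n`. -/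
noncomputable def adj (T : M →+ M) : LaurentSeries M →+ LaurentSeries M :=
  AddMonoidHom.mk'
    (fun A => mkSeries
      (fun p => ∑ᶠ k : ℕ, sgn (p + k) • Ring.choose (p + k) k • T^[k] (lc A (p + k)))
      (by
        obtain ⟨N, hN⟩ := exists_degLE A
        refine ⟨N, fun p hp => finsum_eq_zero_of_forall_eq_zero fun k => ?_⟩
        rw [adj_support hN T p k (by omega), smul_zero, smul_zero]))
    (fun A B => lc_ext fun p => by
      simp only [lc_add, lc_mkSeries]
      rw [← finsum_add_distrib (adj_finite T p A) (adj_finite T p B)]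
      simp only [iterate_add, smul_add])

theorem lc_adj (T : M →+ M) (A : LaurentSeries M) (p : ℤ) : lc (adj T A) p =
    ∑ᶠ k : ℕ, sgn (p + k) • Ring.choose (p + k) k • T^[k] (lc A (p + k)) := by
  simp only [adj, AddMonoidHom.mk'_apply, lc_mkSeries]

theorem DegLE.adj {A : LaurentSeries M} {N : ℤ} (hA : DegLE A N) (T : M →+ M) :
    DegLE (adj T A) N := fun p hp => by
  rw [lc_adj]
  refine finsum_eq_zero_of_forall_eq_zero fun k => ?_
  rw [adj_support hA T p k (by omega), smul_zero, smul_zero]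

theorem lc_smul' (c : ℤ) (A : LaurentSeries M) (n : ℤ) : lc (c • A) n = c • lc A n := rfl

theorem adj_mono (T : M →+ M) (n : ℤ) (a : M) :
    adj T (mono n a) = sgn n • powT T n (mono 0 a) := lc_ext fun p => by
  rw [lc_adj, lc_smul', lc_powT, sgn_smul_finsum]
  refine finsum_congr fun k => ?_
  by_cases h : p + k = n
  · rw [h, lc_mono_same, show p - n + k = 0 by omega, lc_mono_same]
  · rw [lc_mono_of_ne h, lc_mono_of_ne (by omega), iterate_zero']
    simp

theorem adj_mono_zero (T : M →+ M) (a : M) : adj T (mono 0 a) = mono 0 a := by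
  simp [adj_mono]

theorem DegLE.neg {A : LaurentSeries M} {N : ℤ} (hA : DegLE A N) : DegLE (-A) N :=
  fun n hn => by rw [lc_neg, hA n hn, neg_zero]

/-- The substitution y ↦ -y - T sends y + T to -y. -/
theorem adj_del (T : M →+ M) (A : LaurentSeries M) : adj T (del T A) = -shift 1 (adj T A) := by
  refine DFunLike.congr_fun (hom_ext_of_deg (Φ := (adj T).comp (del T))
    (Ψ := -(shift 1).comp (adj T)) (fun n a => ?_) 1
    (fun A N hA => (hA.del T).adj T) (fun A N hA => ((hA.adj T).shift 1).neg)) A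
  simp only [AddMonoidHom.comp_apply, del_mono, map_add, AddMonoidHom.neg_apply, adj_mono, sgn_succ,
    powT_succ, ← mapHom_mono T 0 a]
  rw [← mapHom_powT T T T (fun _ => rfl), del_apply, map_zsmul]
  simp only [neg_smul, smul_add]
  abel

theorem adj_powT (T : M →+ M) (n : ℤ) (A : LaurentSeries M) :
    adj T (powT T n A) = sgn n • shift n (adj T A) := by
  induction n using Int.induction_on with
  | zero => simp [shift_zero]
  | succ n ih =>
    rw [powT_succ, adj_del, ih, sgn_succ, map_zsmul, shift_shift, neg_smul]
  | pred n ih =>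
    have h := adj_del T (powT T (-(n : ℤ) - 1) A)
    rw [← powT_succ, sub_add_cancel, ih] at h
    have h2 := congrArg (fun B => shift (-1) B) h
    simp only [map_neg, shift_shift, map_zsmul, add_neg_cancel, shift_zero] at h2
    rw [eq_comm, neg_eq_iff_eq_neg] at h2
    rw [h2, ← neg_smul]
    congr 1
    have := sgn_succ (-(n : ℤ) - 1)
    rw [sub_add_cancel] at this
    rw [this, neg_neg]

theorem adj_adj (T : M →+ M) (A : LaurentSeries M) : adj T (adj T A) = A := by
  refine DFunLike.congr_fun (hom_ext_of_deg (Φ := (adj T).comp (adj T))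
    (Ψ := AddMonoidHom.id _) (fun n a => ?_) 0
    (fun A N hA => by rw [add_zero]; exact (hA.adj T).adj T)
    (fun A N hA => by rw [add_zero]; exact hA)) A
  simp only [AddMonoidHom.comp_apply, adj_mono, map_zsmul, adj_powT, shift_mono,
    smul_smul, sgn_mul_self, sgn_zero, powT_zero, zero_add, one_smul, AddMonoidHom.id_apply]

theorem adj_natural (f : M →+ M') (T : M →+ M) (T' : M' →+ M') (h : ∀ a, f (T a) = T' (f a))
    (A : LaurentSeries M) : mapHom f (adj T A) = adj T' (mapHom f A) := by
  refine DFunLike.congr_fun (hom_ext_of_deg (Φ := (mapHom f).comp (adj T))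
    (Ψ := (adj T').comp (mapHom f)) (fun n a => ?_) 0
    (fun A N hA => by rw [add_zero]; exact (hA.adj T).mapHom f)
    (fun A N hA => by rw [add_zero]; exact (hA.mapHom f).adj T')) A
  simp only [AddMonoidHom.comp_apply, adj_mono, mapHom_mono, map_zsmul, mapHom_powT f T T' h]

variable {β : M₁ →+ M₂ →+ M} {T₁ : M₁ →+ M₁} {T₂ : M₂ →+ M₂} {T : M →+ M}

theorem adj_star_mono_zero (h : ∀ a b, T (β a b) = β (T₁ a) b + β a (T₂ b)) (a : M₁)
    (B : LaurentSeries M₂) :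
    adj T (mapHom (β a) B) = star β.flip T₁ (adj T₂ B) (mono 0 a) := by
  refine DFunLike.congr_fun (hom_ext_of_deg (Φ := (adj T).comp (mapHom (β a)))
    (Ψ := ((star β.flip T₁).flip (mono 0 a)).comp (adj T₂)) (fun n b => ?_) 0
    (fun A N hA => by rw [add_zero]; exact (hA.mapHom _).adj T)
    (fun A N hA => (hA.adj T₂).star (degLE_mono 0 a) _ _)) B
  simp only [AddMonoidHom.comp_apply, adj_mono, mapHom_mono, map_zsmul, AddMonoidHom.flip_apply]
  rw [star_powT (T := T) (fun b a => by
      rw [AddMonoidHom.flip_apply, AddMonoidHom.flip_apply, AddMonoidHom.flip_apply, h, add_comm]),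
    star_mono_left, powT_zero, mapHom_mono, AddMonoidHom.flip_apply]

/-- Adjoints reverse products. For A = a y ^ n the constant a is handled by `adj_star_mono_zero`,
and the power (y + T₂) ^ n becomes a shift by `adj_powT`. -/
theorem adj_star (h : ∀ a b, T (β a b) = β (T₁ a) b + β a (T₂ b)) (A : LaurentSeries M₁)
    (B : LaurentSeries M₂) :
    adj T (star β T₂ A B) = star β.flip T₁ (adj T₂ B) (adj T₁ A) := by
  obtain ⟨b, hb⟩ := exists_degLE B
  refine DFunLike.congr_fun (hom_ext_of_deg (Φ := (adj T).comp ((star β T₂).flip B))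
    (Ψ := (star β.flip T₁ (adj T₂ B)).comp (adj T₁)) (fun n a => ?_) b
    (fun A N hA => (hA.star hb β T₂).adj T)
    (fun A N hA => by
      rw [add_comm]
      exact (hb.adj T₂).star (hA.adj T₁) _ _)) A
  simp only [AddMonoidHom.comp_apply, AddMonoidHom.flip_apply, star_mono_left, adj_mono, map_zsmul]
  rw [adj_star_mono_zero h, adj_powT, ← star_shift_left, map_zsmul, AddMonoidHom.zsmul_apply]

end Adjoint

/-! ### Pseudodifferential operators and their actions -/

section Actions

variable {F : Type*} [Field F] {V : Type*} [CommRing V] [Algebra F V] (D : Derivation F V V)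

/-- The derivation `D` as an additive map. -/
def dHom : V →+ V := D.toLinearMap.toAddMonoidHom

@[simp] theorem dHom_apply (a : V) : dHom D a = D a := rfl

theorem dHom_iterate (k : ℕ) (a : V) : (dHom D)^[k] a = (D.toLinearMap ^ k) a := by
  rw [Module.End.pow_apply]
  rfl

theorem comp_eq_star (A B : LaurentSeries V) :
    comp D A B = star AddMonoidHom.mul (dHom D) A B := lc_ext fun p => by
  rw [lc_comp, lc_star]
  simp only [dHom_iterate, AddMonoidHom.mul_apply]

theorem negShift_eq_adj (A : LaurentSeries V) : negShift D A = adj (dHom D) A := lc_ext fun p => by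
  simp only [negShift, lc_mkSeries, lc_adj, dHom_iterate, sgn]

theorem lamMul_eq_shift (A : LaurentSeries V) : lamMul A = shift 1 A := lc_ext fun p => by
  rw [lc_shift]
  unfold lc lamMul
  rw [show -p = -(p - 1) + -1 by ring, HahnSeries.coeff_single_mul_add, one_mul]

theorem lc_smul_left (c : V) (A : LaurentSeries V) (n : ℤ) : lc (c • A) n = c * lc A n := rfl

theorem dHom_mul (a b : V) : dHom D (AddMonoidHom.mul a b) =
    AddMonoidHom.mul (dHom D a) b + AddMonoidHom.mul a (dHom D b) := by
  simp [mul_comm, add_comm]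

theorem mul_flip : (AddMonoidHom.mul : V →+ V →+ V).flip = AddMonoidHom.mul := by
  ext a b
  exact mul_comm b a

theorem comp_assoc (A B C : LaurentSeries V) :
    comp D (comp D A B) C = comp D A (comp D B C) := by
  simp only [comp_eq_star]
  exact star_assoc (dHom_mul D) (fun a b c => mul_assoc a b c) A B C

theorem negShift_comp (A B : LaurentSeries V) :
    negShift D (comp D A B) = comp D (negShift D B) (negShift D A) := by
  simp only [comp_eq_star, negShift_eq_adj]
  rw [adj_star (dHom_mul D), mul_flip]

theorem one_eq_mono : (1 : LaurentSeries V) = mono 0 1 := rfl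

theorem comp_one_left (A : LaurentSeries V) : comp D 1 A = A := by
  rw [comp_eq_star, one_eq_mono, star_mono_left, powT_zero]
  exact lc_ext fun p => by simp

theorem comp_one_right (A : LaurentSeries V) : comp D A 1 = A := by
  rw [comp_eq_star]
  refine DFunLike.congr_fun (hom_ext_of_deg
    (Φ := (star AddMonoidHom.mul (dHom D)).flip 1) (Ψ := AddMonoidHom.id _) (fun n a => ?_) 0
    (fun A N hA => hA.star (degLE_mono 0 1) _ _)
    (fun A N hA => by rw [add_zero]; exact hA)) A
  simp only [AddMonoidHom.flip_apply, star_mono_left, one_eq_mono]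
  rw [powT_mono_of_eq_zero _ _ (by simp)]
  simp

/-- Coefficientwise multiplication by `c`. -/
theorem mapHom_mul (c : V) (A : LaurentSeries V) : mapHom (AddMonoidHom.mul c) A = c • A := rfl

theorem comp_smul_left (c : V) (A B : LaurentSeries V) : comp D (c • A) B = c • comp D A B := by
  simp only [comp_eq_star]
  exact (star_natural (β := AddMonoidHom.mul) (β' := AddMonoidHom.mul) (T := dHom D) (T' := dHom D)
    (AddMonoidHom.mul c) (AddMonoidHom.id V) (AddMonoidHom.mul c)
    (fun a b => (mul_assoc c a b).symm) (fun _ => rfl) A B).symm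

theorem del_comp (A B : LaurentSeries V) :
    del (dHom D) (comp D A B) = comp D (del (dHom D) A) B := by
  simp only [comp_eq_star]
  exact (star_del (dHom_mul D) A B).symm

theorem comp_lamMul_right (A B : LaurentSeries V) : comp D A (lamMul B) = lamMul (comp D A B) := by
  simp only [comp_eq_star, lamMul_eq_shift]
  exact star_shift_right _ _ _ _ _

theorem DegLE.comp {A B : LaurentSeries V} {m n : ℤ} (hA : DegLE A m) (hB : DegLE B n) :
    DegLE (comp D A B) (m + n) := by
  rw [comp_eq_star]
  exact hA.star hB _ _

/-- Right multiplication by `A` in the algebra of pseudodifferential operators. -/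
noncomputable def compRight (A : LaurentSeries V) : LaurentSeries V →+ LaurentSeries V :=
  (star AddMonoidHom.mul (dHom D)).flip A

theorem compRight_apply (A B : LaurentSeries V) : compRight D A B = comp D B A := by
  rw [comp_eq_star]
  rfl

end Actions

/-! ### Series in two variables

The elements of `V((x⁻¹))((y⁻¹))` are Laurent series in `y⁻¹` over `V((x⁻¹))`. -/

section Double

variable {F : Type*} [Field F] {V : Type*} [CommRing V] [Algebra F V] (D : Derivation F V V)

/-- The operator `A(x + y + ∂)` on `V((x⁻¹))((y⁻¹))`, expanded in the domain `|y| > |x|`. -/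
noncomputable def actXY (A : LaurentSeries V) :
    LaurentSeries (LaurentSeries V) →+ LaurentSeries (LaurentSeries V) :=
  star (smulAddHom V (LaurentSeries V)) (del (dHom D)) A

/-- The operator `w(x, y) ↦ w(x + ∂, y)_→ A(x)`. -/
noncomputable def rightX (A : LaurentSeries V) :
    LaurentSeries (LaurentSeries V) →+ LaurentSeries (LaurentSeries V) :=
  mapHom (compRight D A)

/-- The operator `w(x, y) ↦ w(x, y + ∂)_→ A(y)`. -/
noncomputable def rightY (A : LaurentSeries V) :
    LaurentSeries (LaurentSeries V) →+ LaurentSeries (LaurentSeries V) :=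
  (star (smulAddHom V (LaurentSeries V)).flip (dHom D)).flip A

theorem del_smul (a : V) (B : LaurentSeries V) : del (dHom D) (smulAddHom V (LaurentSeries V) a B) =
    smulAddHom V (LaurentSeries V) (dHom D a) B +
      smulAddHom V (LaurentSeries V) a (del (dHom D) B) := lc_ext fun p => by
  simp only [smulAddHom_apply, lc_del, lc_add, lc_smul_left, dHom_apply, Derivation.leibniz,
    smul_eq_mul]
  ring

/-- V((x⁻¹))((y⁻¹)) is a left module over pseudodifferential operators, with ∂ acting as x + y + ∂.
-/
theorem actXY_comp (A B : LaurentSeries V) (w : LaurentSeries (LaurentSeries V)) :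
    actXY D (comp D A B) w = actXY D A (actXY D B w) := by
  rw [comp_eq_star]
  exact star_assoc (del_smul D) (fun a b c => mul_smul a b c) A B w

theorem actXY_mono_zero (a : V) (w : LaurentSeries (LaurentSeries V)) :
    actXY D (mono 0 a) w = mapHom (smulAddHom V (LaurentSeries V) a) w := by
  rw [actXY, star_mono_left, powT_zero]

theorem actXY_one (w : LaurentSeries (LaurentSeries V)) : actXY D 1 w = w := by
  rw [one_eq_mono, actXY_mono_zero]
  exact lc_ext fun n => by simp

theorem actXY_sum {ι : Type*} (s : Finset ι) (A : ι → LaurentSeries V)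
    (w : LaurentSeries (LaurentSeries V)) :
    actXY D (∑ i ∈ s, A i) w = ∑ i ∈ s, actXY D (A i) w := by
  simp only [actXY, map_sum, AddMonoidHom.finsetSum_apply]

theorem actXY_zero (w : LaurentSeries (LaurentSeries V)) : actXY D 0 w = 0 := by
  simp only [actXY, map_zero, AddMonoidHom.zero_apply]

/-- Composition on the right is V-linear and commutes with x + ∂, hence it is natural for the left
action. -/
theorem rightX_actXY (A B : LaurentSeries V) (w : LaurentSeries (LaurentSeries V)) :
    rightX D A (actXY D B w) = actXY D B (rightX D A w) := by
  refine star_natural (β := smulAddHom V (LaurentSeries V)) (β' := smulAddHom V (LaurentSeries V))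
    (T := del (dHom D)) (T' := del (dHom D)) (AddMonoidHom.id V) (compRight D A) (compRight D A)
    (fun a b => ?_) (fun b => ?_) B w
  · simp only [compRight_apply, smulAddHom_apply, comp_smul_left, AddMonoidHom.id_apply]
  · rw [compRight_apply, compRight_apply, del_comp]

theorem rightY_actXY (A B : LaurentSeries V) (w : LaurentSeries (LaurentSeries V)) :
    rightY D A (actXY D B w) = actXY D B (rightY D A w) :=
  star_assoc (β := smulAddHom V (LaurentSeries V)) (γ := (smulAddHom V (LaurentSeries V)).flip)
    (β' := (smulAddHom V (LaurentSeries V)).flip) (γ' := smulAddHom V (LaurentSeries V))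
    (T₂ := del (dHom D)) (T₃ := dHom D) (T := del (dHom D))
    (fun b c => by
      simp only [AddMonoidHom.flip_apply]
      rw [del_smul, add_comm])
    (fun a b c => smul_comm c a b) B w A

/-- The product `f(x) g(y)`. -/
noncomputable def tens (f : LaurentSeries V) :
    LaurentSeries V →+ LaurentSeries (LaurentSeries V) :=
  mapHom ((smulAddHom V (LaurentSeries V)).flip f)

theorem lc_tens (f g : LaurentSeries V) (j : ℤ) : lc (tens f g) j = lc g j • f := rfl

theorem lc_lc_tens (f g : LaurentSeries V) (i j : ℤ) : lc (lc (tens f g) j) i = lc g j * lc f i := rfl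

theorem rightX_tens (A f g : LaurentSeries V) :
    rightX D A (tens f g) = tens (comp D f A) g := lc_ext fun j => by
  rw [rightX, lc_mapHom, lc_tens, lc_tens, compRight_apply, comp_smul_left]

theorem rightY_tens (A f g : LaurentSeries V) :
    rightY D A (tens f g) = tens f (comp D g A) := by
  rw [comp_eq_star]
  exact (star_natural (β := AddMonoidHom.mul) (β' := (smulAddHom V (LaurentSeries V)).flip)
    (T := dHom D) (T' := dHom D) ((smulAddHom V (LaurentSeries V)).flip f) (AddMonoidHom.id V)
    ((smulAddHom V (LaurentSeries V)).flip f)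
    (fun a b => by
      simp only [AddMonoidHom.flip_apply, smulAddHom_apply, AddMonoidHom.mul_apply,
        AddMonoidHom.id_apply]
      rw [mul_comm, mul_smul])
    (fun _ => rfl) g A).symm

/-- The total degree of `w` is at most `d`. -/
def TotalDegLE (w : LaurentSeries (LaurentSeries V)) (d : ℤ) : Prop :=
  ∀ j, DegLE (lc w j) (d - j)

theorem degLE_iterate_del {B : LaurentSeries V} {N : ℤ} (hB : DegLE B N) (k : ℕ) :
    DegLE ((del (dHom D))^[k] B) (N + k) := by
  induction k with
  | zero => simpa using hB
  | succ k ih =>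
    rw [Function.iterate_succ_apply']
    have := ih.del (dHom D)
    push_cast
    rwa [← add_assoc]

theorem map_binomSum {M M' : Type*} [AddCommGroup M] [AddCommGroup M'] (f : M →+ M')
    {T : ℤ → ℕ → M} (hT : BddFamily T) : f (binomSum T) = binomSum fun n k => f (T n k) := by
  unfold binomSum
  rw [AddMonoidHom.map_finsum _ (hT.finite_smul _)]
  simp only [map_zsmul]

theorem lc_lc_actXY (A : LaurentSeries V) (w : LaurentSeries (LaurentSeries V)) (i j : ℤ) :
    lc (lc (actXY D A w) j) i =
      binomSum fun n k => lc A n * lc ((del (dHom D))^[k] (lc w (j - n + k))) i := by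
  rw [actXY, lc_star, ← lcHom_apply (M := V), map_binomSum _ (star_bddFamily _ _ _ _ _)]
  rfl

theorem lc_lc_rightY (A : LaurentSeries V) (w : LaurentSeries (LaurentSeries V)) (i j : ℤ) :
    lc (lc (rightY D A w) j) i =
      binomSum fun n k => (dHom D)^[k] (lc A (j - n + k)) * lc (lc w n) i := by
  rw [rightY, AddMonoidHom.flip_apply, lc_star, ← lcHom_apply (M := V),
    map_binomSum _ (star_bddFamily _ _ _ _ _)]
  rfl

/-- Total degree is the filtration suited to this action: expanding (x + y + ∂) ^ n trades powers of
y for powers of x, so the degree in x alone is not controlled. -/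
theorem TotalDegLE.actXY {A : LaurentSeries V} {w : LaurentSeries (LaurentSeries V)} {a d : ℤ}
    (hA : DegLE A a) (hw : TotalDegLE w d) : TotalDegLE (actXY D A w) (d + a) := fun j i hi => by
  rw [lc_lc_actXY]
  refine binomSum_eq_zero fun n k => ?_
  by_cases hn : n ≤ a
  · rw [degLE_iterate_del D (hw (j - n + k)) k i (by omega), mul_zero]
  · rw [hA n (by omega), zero_mul]

theorem TotalDegLE.rightX {A : LaurentSeries V} {w : LaurentSeries (LaurentSeries V)} {a d : ℤ}
    (hA : DegLE A a) (hw : TotalDegLE w d) : TotalDegLE (rightX D A w) (d + a) := fun j i hi => by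
  rw [NonlocalPVA.rightX, lc_mapHom, compRight_apply]
  exact (hw j).comp D hA i (by omega)

theorem TotalDegLE.rightY {A : LaurentSeries V} {w : LaurentSeries (LaurentSeries V)} {a d : ℤ}
    (hA : DegLE A a) (hw : TotalDegLE w d) : TotalDegLE (rightY D A w) (d + a) := fun j i hi => by
  rw [lc_lc_rightY]
  refine binomSum_eq_zero fun n k => ?_
  by_cases hn : j - n + k ≤ a
  · rw [hw n i (by omega), mul_zero]
  · rw [hA _ (by omega), iterate_zero', zero_mul]

theorem totalDegLE_tens {f g : LaurentSeries V} {a b : ℤ} (hf : DegLE f a) (hg : DegLE g b) :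
    TotalDegLE (tens f g) (a + b) := fun j i hi => by
  rw [lc_lc_tens]
  by_cases hj : j ≤ b
  · rw [hf i (by omega), mul_zero]
  · rw [hg j (by omega), zero_mul]

end Double

/-! ### Series in three variables -/

section Triple

variable {F : Type*} [Field F] {V : Type*} [CommRing V] [Algebra F V] (D : Derivation F V V)

theorem series3_ext {P Q : Series3 F V} (h : ∀ m n p, P.1 m n p = Q.1 m n p) : P = Q := by
  apply Subtype.ext
  funext m n p
  exact h m n p

/-- The series in the first variable obtained by fixing the exponents of the other two. -/
noncomputable def slice (n p : ℤ) : Series3 F V →+ LaurentSeries V where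
  toFun P := mkSeries (fun m => P.1 m n p) (by
    obtain ⟨N, hN⟩ := P.2
    exact ⟨N, fun m hm => hN m n p (Or.inl hm)⟩)
  map_zero' := lc_ext fun m => by rw [lc_mkSeries]; rfl
  map_add' P Q := lc_ext fun m => by simp only [lc_add, lc_mkSeries]; rfl

@[simp] theorem lc_slice (n p : ℤ) (P : Series3 F V) (m : ℤ) :
    lc (slice n p P) m = P.1 m n p := by
  simp only [slice, AddMonoidHom.coe_mk, ZeroHom.coe_mk, lc_mkSeries]

/-- The additive map `f` raises degrees by a bounded amount. -/
def BddDeg {M M' : Type*} [AddCommGroup M] [AddCommGroup M']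
    (f : LaurentSeries M →+ LaurentSeries M') : Prop :=
  ∃ c, ∀ A N, DegLE A N → DegLE (f A) (N + c)

/-- The map that applies `f` in the first variable. -/
noncomputable def onFirst (f : LaurentSeries V →+ LaurentSeries V) (hf : BddDeg f) :
    Series3 F V →+ Series3 F V where
  toFun P := ⟨fun m n p => lc (f (slice n p P)) m, by
    obtain ⟨N, hN⟩ := P.2
    obtain ⟨c, hc⟩ := hf
    refine ⟨max N (N + c), fun m n p h => ?_⟩
    by_cases h' : N < n ∨ N < p
    · beta_reduce
      have : slice n p P = 0 := lc_ext fun m => by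
        rw [lc_slice, hN m n p (Or.inr h'), lc_zero]
      rw [this, map_zero, lc_zero]
    · refine hc _ N (fun m hm => ?_) m (by omega)
      rw [lc_slice, hN m n p (Or.inl hm)]⟩
  map_zero' := series3_ext fun m n p => by simp
  map_add' P Q := series3_ext fun m n p => by simp

theorem onFirst_coe (f : LaurentSeries V →+ LaurentSeries V) (hf : BddDeg f) (P : Series3 F V)
    (m n p : ℤ) : (onFirst f hf P).1 m n p = lc (f (slice n p P)) m := rfl

/-- The cyclic permutation of the variables, `(x, y, z) ↦ (y, z, x)` on exponents. -/
def cyc : Series3 F V →+ Series3 F V where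
  toFun P := ⟨fun x y z => P.1 y z x, by
    obtain ⟨N, hN⟩ := P.2
    exact ⟨N, fun x y z h => hN _ _ _ (by omega)⟩⟩
  map_zero' := rfl
  map_add' _ _ := rfl

@[simp] theorem cyc_coe (P : Series3 F V) (x y z : ℤ) : (cyc P).1 x y z = P.1 y z x := rfl

/-- The exchange of the first two variables. -/
def swap : Series3 F V →+ Series3 F V where
  toFun P := ⟨fun x y z => P.1 y x z, by
    obtain ⟨N, hN⟩ := P.2
    exact ⟨N, fun x y z h => hN _ _ _ (by omega)⟩⟩
  map_zero' := rfl
  map_add' _ _ := rfl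

variable (F) in
/-- The product `f(λ₁) g(λ₂) h(λ₃)`. -/
noncomputable def pure3 (f g h : LaurentSeries V) :
    Series3 F V :=
  ⟨fun m n p => lc f m * lc g n * lc h p, by
    obtain ⟨a, ha⟩ := exists_degLE f
    obtain ⟨b, hb⟩ := exists_degLE g
    obtain ⟨c, hc⟩ := exists_degLE h
    refine ⟨max a (max b c), fun m n p hh => ?_⟩
    beta_reduce
    rcases hh with hh | hh | hh
    · rw [ha m (by omega), zero_mul, zero_mul]
    · rw [hb n (by omega), mul_zero, zero_mul]
    · rw [hc p (by omega), mul_zero]⟩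

theorem pure3_coe (f g h : LaurentSeries V) (m n p : ℤ) :
    (pure3 F f g h).1 m n p = lc f m * lc g n * lc h p := rfl

theorem cyc_pure3 (f g h : LaurentSeries V) : cyc (pure3 F f g h) = pure3 F h f g :=
  series3_ext fun x y z => by rw [cyc_coe, pure3_coe, pure3_coe]; ring

theorem slice_pure3 (f g h : LaurentSeries V) (n p : ℤ) :
    slice n p (pure3 F f g h) = (lc g n * lc h p) • f := lc_ext fun m => by
  rw [lc_slice, pure3_coe, lc_smul_left]
  ring

/-- The total degree of `P` is at most `d`. -/
def Deg3LE (P : Series3 F V) (d : ℤ) : Prop := ∀ m n p, d < m + n + p → P.1 m n p = 0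

theorem degLE_pure3 {f g h : LaurentSeries V} {a b c : ℤ} (hf : DegLE f a) (hg : DegLE g b)
    (hh : DegLE h c) : Deg3LE (pure3 F f g h) (a + b + c) := fun m n p hd => by
  rw [pure3_coe]
  by_cases h1 : a < m
  · rw [hf m h1, zero_mul, zero_mul]
  by_cases h2 : b < n
  · rw [hg n h2, mul_zero, zero_mul]
  · rw [hh p (by omega), mul_zero]

theorem Deg3LE.cyc {P : Series3 F V} {d : ℤ} (h : Deg3LE P d) : Deg3LE (cyc P) d :=
  fun _ _ _ hd => h _ _ _ (by omega)

theorem Deg3LE.onFirst {P : Series3 F V} {d : ℤ} (h : Deg3LE P d)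
    {f : LaurentSeries V →+ LaurentSeries V} (hf : BddDeg f) {c : ℤ}
    (hc : ∀ A N, DegLE A N → DegLE (f A) (N + c)) :
    Deg3LE (onFirst f hf P) (d + c) := fun m n p hd => by
  rw [onFirst_coe]
  refine hc _ (d - n - p) (fun m hm => ?_) m (by omega)
  rw [lc_slice, h _ _ _ (by omega)]

/-- Two additive maps on series in three variables agree if they do so on the products
`λ₁ ^ m * λ₂ ^ n * B(λ₃)` and on series of low total degree. -/
theorem series3_hom_ext {M : Type*} [AddCommGroup M] {Φ Ψ : Series3 F V →+ M}
    (hp : ∀ m n B, Φ (pure3 F (mono m 1) (mono n 1) B) = Ψ (pure3 F (mono m 1) (mono n 1) B))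
    (d : ℤ) (hlow : ∀ P : Series3 F V, Deg3LE P d → Φ P = Ψ P) : Φ = Ψ := by
  ext P
  obtain ⟨N, hN⟩ := P.2
  -- With all exponents at most N, a total degree above d forces each of them to be at least d - 2 *
  -- N. So removing the finitely many pairs of exponents in this window leaves only terms of total
  -- degree at most d.
  set I := Finset.Icc (d - 2 * N) N with hI
  set B : ℤ → ℤ → LaurentSeries V := fun m n => slice m n (cyc P) with hB
  set Q : Series3 F V := ∑ m ∈ I, ∑ n ∈ I, pure3 F (mono m 1) (mono n 1) (B m n) with hQ
  have hQc : ∀ m n p, Q.1 m n p = if m ∈ I ∧ n ∈ I then P.1 m n p else 0 := by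
    intro m n p
    have hev : ∀ R : Series3 F V, R.1 m n p = lc (slice n p R) m := fun R => (lc_slice n p R m).symm
    rw [hev, hQ]
    simp only [map_sum, lc_sum, lc_slice, pure3_coe, lc_mono, hB, cyc_coe]
    simp only [ite_mul, one_mul, zero_mul, mul_ite, mul_one, mul_zero, Finset.sum_ite_eq]
    split_ifs <;> simp_all
  have h1 : Φ Q = Ψ Q := by
    rw [hQ]
    simp only [map_sum, hp]
  have h2 : Φ (P - Q) = Ψ (P - Q) := by
    refine hlow _ fun m n p hd => ?_
    have : (P - Q).1 m n p = P.1 m n p - Q.1 m n p := rfl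
    rw [this, hQc]
    split_ifs with h
    · exact sub_self _
    · rw [sub_zero]
      refine hN m n p ?_
      simp only [hI, Finset.mem_Icc] at h
      omega
  have : P = (P - Q) + Q := by abel
  rw [this, map_add, map_add, h1, h2]

/-- Two endomorphisms of bounded degree agree if they agree on the products
`λ₁ ^ m * λ₂ ^ n * B(λ₃)`. -/
theorem series3_end_ext {Φ Ψ : Series3 F V →+ Series3 F V}
    (hp : ∀ m n B, Φ (pure3 F (mono m 1) (mono n 1) B) = Ψ (pure3 F (mono m 1) (mono n 1) B))
    (c : ℤ) (hΦ : ∀ (P : Series3 F V) d, Deg3LE P d → Deg3LE (Φ P) (d + c))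
    (hΨ : ∀ (P : Series3 F V) d, Deg3LE P d → Deg3LE (Ψ P) (d + c)) (P : Series3 F V) :
    Φ P = Ψ P := series3_ext fun m n p => by
  have := series3_hom_ext (Φ := ((lcHom m).comp (slice n p)).comp Φ)
    (Ψ := ((lcHom m).comp (slice n p)).comp Ψ) (fun m n B => by simp [hp]) (m + n + p - c - 1)
    (fun P hP => by
      simp only [AddMonoidHom.comp_apply, lcHom_apply, lc_slice]
      rw [hΦ P _ hP m n p (by omega), hΨ P _ hP m n p (by omega)])
  simpa using DFunLike.congr_fun this P

theorem bddDeg_compRight (A : LaurentSeries V) : BddDeg (compRight D A) := by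
  obtain ⟨a, ha⟩ := exists_degLE A
  exact ⟨a, fun B N hB => hB.star ha _ _⟩

theorem bddDeg_adj : BddDeg (adj (dHom D)) :=
  ⟨0, fun A N hA => by rw [add_zero]; exact hA.adj _⟩

/-- Composition with `A` on the right in the first variable. -/
noncomputable def right₁ (A : LaurentSeries V) : Series3 F V →+ Series3 F V :=
  onFirst (compRight D A) (bddDeg_compRight D A)

/-- Composition with `A` on the right in the second variable. -/
noncomputable def right₂ (A : LaurentSeries V) : Series3 F V →+ Series3 F V :=
  cyc.comp ((right₁ D A).comp (cyc.comp cyc))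

/-- Composition with `A` on the right in the third variable. -/
noncomputable def right₃ (A : LaurentSeries V) : Series3 F V →+ Series3 F V :=
  (cyc.comp cyc).comp ((right₁ D A).comp cyc)

/-- The adjoint in the third variable. -/
noncomputable def adj₃ : Series3 F V →+ Series3 F V :=
  (cyc.comp cyc).comp ((onFirst (adj (dHom D)) (bddDeg_adj D)).comp cyc)

/-- Permuting the variables permutes the three compositions, which are conjugates of the first one
by `cyc`. -/
theorem cyc_right₁ (A : LaurentSeries V) (P : Series3 F V) :
    cyc (right₁ D A P) = right₂ D A (cyc P) := rfl

theorem cyc_right₂ (A : LaurentSeries V) (P : Series3 F V) :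
    cyc (right₂ D A P) = right₃ D A (cyc P) := rfl

theorem cyc_right₃ (A : LaurentSeries V) (P : Series3 F V) :
    cyc (right₃ D A P) = right₁ D A (cyc P) := rfl

theorem swap_right₁ (A : LaurentSeries V) (P : Series3 F V) :
    swap (right₁ D A P) = right₂ D A (swap P) := rfl

theorem swap_right₂ (A : LaurentSeries V) (P : Series3 F V) :
    swap (right₂ D A P) = right₁ D A (swap P) := rfl

theorem swap_right₃ (A : LaurentSeries V) (P : Series3 F V) :
    swap (right₃ D A P) = right₃ D A (swap P) := rfl

theorem swap_adj₃ (P : Series3 F V) : swap (adj₃ D P) = adj₃ D (swap P) := rfl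

theorem right₁_pure3 (A f g h : LaurentSeries V) :
    right₁ D A (pure3 F f g h) = pure3 F (comp D f A) g h := series3_ext fun m n p => by
  rw [right₁, onFirst_coe, slice_pure3, compRight_apply, comp_smul_left, pure3_coe, lc_smul_left]
  ring

theorem right₂_pure3 (A f g h : LaurentSeries V) :
    right₂ D A (pure3 F f g h) = pure3 F f (comp D g A) h := by
  simp only [right₂, AddMonoidHom.comp_apply, cyc_pure3, right₁_pure3]

theorem right₃_pure3 (A f g h : LaurentSeries V) :
    right₃ D A (pure3 F f g h) = pure3 F f g (comp D h A) := by
  simp only [right₃, AddMonoidHom.comp_apply, cyc_pure3, right₁_pure3]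

theorem Deg3LE.right₁ {P : Series3 F V} {d : ℤ} (h : Deg3LE P d) {A : LaurentSeries V} {a : ℤ}
    (hA : DegLE A a) : Deg3LE (right₁ D A P) (d + a) :=
  h.onFirst _ fun _ _ hB => hB.star hA _ _

theorem Deg3LE.right₂ {P : Series3 F V} {d : ℤ} (h : Deg3LE P d) {A : LaurentSeries V} {a : ℤ}
    (hA : DegLE A a) : Deg3LE (right₂ D A P) (d + a) :=
  (h.cyc.cyc.right₁ D hA).cyc

theorem Deg3LE.right₃ {P : Series3 F V} {d : ℤ} (h : Deg3LE P d) {A : LaurentSeries V} {a : ℤ}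
    (hA : DegLE A a) : Deg3LE (right₃ D A P) (d + a) :=
  (h.cyc.right₁ D hA).cyc.cyc

theorem Deg3LE.adj₃ {P : Series3 F V} {d : ℤ} (h : Deg3LE P d) : Deg3LE (adj₃ D P) d := by
  have := (h.cyc.onFirst (f := adj (dHom D)) (bddDeg_adj D) (c := 0)
    fun _ _ hB => by rw [add_zero]; exact hB.adj _).cyc.cyc
  rwa [add_zero] at this

/-- On a product of series the two operations act on different factors. -/
theorem right₁_right₂ (A B : LaurentSeries V) (P : Series3 F V) :
    right₁ D A (right₂ D B P) = right₂ D B (right₁ D A P) := by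
  obtain ⟨a, ha⟩ := exists_degLE A
  obtain ⟨b, hb⟩ := exists_degLE B
  refine series3_end_ext (Φ := (right₁ D A).comp (right₂ D B)) (Ψ := (right₂ D B).comp (right₁ D A))
    (fun m n C => ?_) (a + b)
    (fun P d hP => by
      rw [add_comm a b, ← add_assoc]
      exact (hP.right₂ D hb).right₁ D ha)
    (fun P d hP => by
      rw [← add_assoc]
      exact (hP.right₁ D ha).right₂ D hb) P
  simp only [AddMonoidHom.comp_apply, right₁_pure3, right₂_pure3]

theorem right₃_right₁ (A B : LaurentSeries V) (P : Series3 F V) :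
    right₃ D A (right₁ D B P) = right₁ D B (right₃ D A P) :=
  congrArg (fun Q => cyc (cyc Q)) (right₁_right₂ D A B (cyc P))

theorem right₂_right₃ (A B : LaurentSeries V) (P : Series3 F V) :
    right₂ D A (right₃ D B P) = right₃ D B (right₂ D A P) :=
  congrArg cyc (right₁_right₂ D A B (cyc (cyc P)))

/-! ### The relation `λ₁ + λ₂ + λ₃ + ∂` -/

theorem bddDeg_del : BddDeg (del (dHom D)) := ⟨1, fun _ _ hA => hA.del _⟩

theorem bddDeg_shift : BddDeg (shift 1 : LaurentSeries V →+ LaurentSeries V) :=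
  ⟨1, fun _ _ hA => hA.shift 1⟩

/-- The operator `λ₁ + λ₂ + λ₃ + ∂`. -/
noncomputable def momentum : Series3 F V →+ Series3 F V :=
  onFirst (del (dHom D)) (bddDeg_del D) +
    (cyc.comp ((onFirst (shift 1) bddDeg_shift).comp (cyc.comp cyc)) +
      (cyc.comp cyc).comp ((onFirst (shift 1) bddDeg_shift).comp cyc))

theorem momentum_coe (P : Series3 F V) (m n p : ℤ) : (momentum D P).1 m n p =
    P.1 (m - 1) n p + D (P.1 m n p) + (P.1 m (n - 1) p + P.1 m n (p - 1)) := by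
  have : (momentum D P).1 m n p = lc (del (dHom D) (slice n p P)) m +
    (lc (shift 1 (slice p m (cyc (cyc P)))) n + lc (shift 1 (slice m n (cyc P))) p) := rfl
  rw [this]
  simp

theorem Deg3LE.momentum {P : Series3 F V} {d : ℤ} (h : Deg3LE P d) :
    Deg3LE (momentum D P) (d + 1) := fun m n p hd => by
  rw [momentum_coe, h _ _ _ (by omega), h _ _ _ (by omega), h _ _ _ (by omega),
    h _ _ _ (by omega), map_zero]
  simp

theorem momentum_cyc (P : Series3 F V) : momentum D (cyc P) = cyc (momentum D P) :=
  series3_ext fun m n p => by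
    rw [cyc_coe, momentum_coe, momentum_coe]
    simp only [cyc_coe]
    abel

theorem series3_add_coe (P Q : Series3 F V) (m n p : ℤ) :
    (P + Q).1 m n p = P.1 m n p + Q.1 m n p := rfl

theorem series3_sub_coe (P Q : Series3 F V) (m n p : ℤ) :
    (P - Q).1 m n p = P.1 m n p - Q.1 m n p := rfl

theorem series3_neg_coe (P : Series3 F V) (m n p : ℤ) : (-P).1 m n p = -P.1 m n p := rfl

/-- The derivation of a product splits over the three factors, so λ₁ + λ₂ + λ₃ + ∂ acts by left
multiplication by ∂ in one factor at a time. This is why it commutes with composition on the right.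
-/
theorem momentum_pure3 (f g h : LaurentSeries V) : momentum D (pure3 F f g h) =
    pure3 F (del (dHom D) f) g h + pure3 F f (del (dHom D) g) h + pure3 F f g (del (dHom D) h) :=
  series3_ext fun m n p => by
    simp only [momentum_coe, series3_add_coe, pure3_coe, lc_del, Derivation.leibniz, dHom_apply,
      smul_eq_mul]
    ring

theorem right₁_momentum (A : LaurentSeries V) (P : Series3 F V) :
    right₁ D A (momentum D P) = momentum D (right₁ D A P) := by
  obtain ⟨a, ha⟩ := exists_degLE A
  refine series3_end_ext (Φ := (right₁ D A).comp (momentum D))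
    (Ψ := (momentum D).comp (right₁ D A)) (fun m n C => ?_) (a + 1)
    (fun P d hP => by
      rw [add_comm a 1, ← add_assoc]
      exact (hP.momentum D).right₁ D ha)
    (fun P d hP => by
      rw [← add_assoc]
      exact (hP.right₁ D ha).momentum D) P
  simp only [AddMonoidHom.comp_apply, momentum_pure3, map_add, right₁_pure3, del_comp]

theorem right₂_momentum (A : LaurentSeries V) (P : Series3 F V) :
    right₂ D A (momentum D P) = momentum D (right₂ D A P) := by
  simp only [right₂, AddMonoidHom.comp_apply, ← momentum_cyc, right₁_momentum]

theorem right₃_momentum (A : LaurentSeries V) (P : Series3 F V) :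
    right₃ D A (momentum D P) = momentum D (right₃ D A P) := by
  simp only [right₃, AddMonoidHom.comp_apply, ← momentum_cyc, right₁_momentum]

theorem adj₃_adj₃ (P : Series3 F V) : adj₃ D (adj₃ D P) = P := series3_ext fun m n p => by
  have hs : ∀ Q : Series3 F V, slice m n (cyc (adj₃ D Q)) = adj (dHom D) (slice m n (cyc Q)) :=
    fun Q => lc_ext fun p => lc_slice _ _ _ _
  have h : ∀ Q : Series3 F V, Q.1 m n p = lc (slice m n (cyc Q)) p :=
    fun Q => (lc_slice m n (cyc Q) p).symm
  rw [h, hs, hs, adj_adj, ← h]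

/-- The coefficients 1 matter: the adjoint differentiates whole coefficients, and only constants can
be pulled out of it. -/
theorem adj₃_pure3 (m n : ℤ) (B : LaurentSeries V) :
    adj₃ D (pure3 F (mono m 1) (mono n 1) B) =
      pure3 F (mono m 1) (mono n 1) (adj (dHom D) B) := series3_ext fun i j p => by
  have : (adj₃ D (pure3 F (mono m 1) (mono n 1) B)).1 i j p =
    lc (adj (dHom D) (slice i j (cyc (pure3 F (mono m 1) (mono n 1) B)))) p := rfl
  rw [this, cyc_pure3, slice_pure3, pure3_coe]
  by_cases hi : i = m
  · by_cases hj : j = n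
    · simp [hi, hj]
    · simp [lc_mono_of_ne hj]
  · simp [lc_mono_of_ne hi]

theorem relMul_pure3 (f g h : LaurentSeries V) : relMul (F := F) (pure3 F f g h) =
    pure3 F f g (shift 1 h) - pure3 F (shift 1 f) g h - pure3 F f (shift 1 g) h :=
  series3_ext fun m n p => by
    simp only [series3_sub_coe, pure3_coe, lc_shift]
    rfl

theorem Deg3LE.relMul {P : Series3 F V} {d : ℤ} (h : Deg3LE P d) :
    Deg3LE (relMul P) (d + 1) := fun m n p hd => by
  show P.1 m n (p - 1) - P.1 (m - 1) n p - P.1 m (n - 1) p = 0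
  rw [h _ _ _ (by omega), h _ _ _ (by omega), h _ _ _ (by omega), sub_zero, sub_zero]

theorem del_mono_one (m : ℤ) : del (dHom D) (mono m 1) = shift 1 (mono m (1 : V)) := by
  rw [del_apply, mapHom_mono, dHom_apply, D.map_one_eq_zero]
  simp [mono]

theorem pure3_neg (f g h : LaurentSeries V) : pure3 F f g (-h) = -pure3 F f g h :=
  series3_ext fun m n p => by
    simp only [series3_neg_coe, pure3_coe, lc_neg, mul_neg]

/-- Under λ₃ = -ν - ∂ the operator λ₁ + λ₂ + λ₃ + ∂ becomes λ₁ + λ₂ - ν. Thus V_{λ,μ} is also the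
quotient by `momentum`, where the three variables play equal roles. -/
theorem adj₃_momentum (P : Series3 F V) : adj₃ D (momentum D P) = -relMul (adj₃ D P) := by
  refine series3_end_ext (Φ := (adj₃ D).comp (momentum D))
    (Ψ := -(relMul (F := F) (V := V)).toAddMonoidHom.comp (adj₃ D)) (fun m n C => ?_) 1
    (fun P d hP => (hP.momentum D).adj₃ D)
    (fun P d hP m n p h => by
      have := (hP.adj₃ D).relMul m n p h
      show -((relMul (adj₃ D P)).1 m n p) = 0
      rw [this, neg_zero]) P
  simp only [AddMonoidHom.comp_apply, momentum_pure3, map_add, AddMonoidHom.neg_apply,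
    LinearMap.toAddMonoidHom_coe, del_mono_one, shift_mono, adj₃_pure3, relMul_pure3, adj_del,
    pure3_neg]
  abel

end Triple

/-! ### The embeddings of `V_{λ,μ}` -/

section Embeddings

variable {F : Type*} [Field F] {V : Type*} [CommRing V] [Algebra F V] (D : Derivation F V V)

theorem iotaML_mk (Q : Series3 F V) (i j : ℤ) :
    iotaML F V (Submodule.Quotient.mk Q) i j =
      binomSum fun p k => Q.1 (i - k) (j - p + k) p := rfl

theorem iotaLM_mk (Q : Series3 F V) (i j : ℤ) :
    iotaLM F V (Submodule.Quotient.mk Q) i j =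
      iotaML F V (Submodule.Quotient.mk (swap Q)) i j := rfl

theorem iotaLN_mk (Q : Series3 F V) (i j : ℤ) :
    iotaLN F V (Submodule.Quotient.mk Q) i j =
      binomSum fun n k => sgn (n - k) • Q.1 (j - n + k) n (i - k) := rfl

/-- The embedding of `V_{λ,μ}` in `V((λ⁻¹))((μ⁻¹))`, with values in iterated Laurent series. -/
noncomputable def expandML : Series3 F V →+ LaurentSeries (LaurentSeries V) where
  toFun Q := mkSeries
    (fun j => mkSeries (fun i => iotaML F V (Submodule.Quotient.mk Q) i j) (by
      obtain ⟨N, hN⟩ := Q.2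
      refine ⟨3 * N - j, fun i hi => binomSum_eq_zero fun p k => hN _ _ _ ?_⟩
      omega))
    (by
      obtain ⟨N, hN⟩ := Q.2
      refine ⟨2 * N, fun j hj => lc_ext fun i => ?_⟩
      rw [lc_mkSeries]
      refine binomSum_eq_zero fun p k => hN _ _ _ ?_
      omega)
  map_zero' := lc_ext fun j => lc_ext fun i => by
    simp only [lc_mkSeries, Submodule.Quotient.mk_zero, map_zero]
    rfl
  map_add' P Q := lc_ext fun j => lc_ext fun i => by
    simp only [lc_add, lc_mkSeries, Submodule.Quotient.mk_add, map_add]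
    rfl

theorem lc_lc_expandML (Q : Series3 F V) (i j : ℤ) :
    lc (lc (expandML Q) j) i = iotaML F V (Submodule.Quotient.mk Q) i j := by
  simp only [expandML, AddMonoidHom.coe_mk, ZeroHom.coe_mk, lc_mkSeries]

theorem totalDegLE_expandML {Q : Series3 F V} {d : ℤ} (h : Deg3LE Q d) :
    TotalDegLE (expandML Q) d := fun j i hi => by
  rw [lc_lc_expandML, iotaML_mk]
  exact binomSum_eq_zero fun p k => h _ _ _ (by omega)

theorem iterate_del_mono_one (m : ℤ) (k : ℕ) :
    (del (dHom D))^[k] (mono m (1 : V)) = mono (m + k) 1 := by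
  induction k with
  | zero => simp
  | succ k ih =>
    rw [Function.iterate_succ_apply', ih, del_mono_one, shift_mono]
    push_cast
    rw [add_assoc]

theorem iterate_del_zero (k : ℕ) : (del (dHom D))^[k] (0 : LaurentSeries V) = 0 :=
  iterate_zero' _ k

/-- Since ∂ kills the coefficient 1, the powers of ν = x + y may be replaced by those of x + y + ∂
on these products. -/
theorem expandML_pure3 (m n : ℤ) (B : LaurentSeries V) :
    expandML (pure3 F (mono m 1) (mono n 1) B) =
      actXY D B (tens (mono m 1) (mono n 1)) := lc_ext fun j => lc_ext fun i => by
  rw [lc_lc_expandML, iotaML_mk, lc_lc_actXY]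
  congr 1
  funext p k
  rw [pure3_coe, lc_tens, mul_comm]
  by_cases h : j - p + k = n
  · rw [h, lc_mono_same, one_smul, iterate_del_mono_one, mul_one]
    congr 1
    rw [lc_mono, lc_mono]
    congr 1
    simp only [eq_iff_iff]
    omega
  · rw [lc_mono_of_ne h, zero_smul, iterate_del_zero]
    simp

/-- The embedding in `V((x⁻¹))((y⁻¹))` in the coordinates `λ₁ = x`, `λ₂ = y`,
`λ₃ = -x - y - ∂`. -/
noncomputable def embed : Series3 F V →+ LaurentSeries (LaurentSeries V) :=
  expandML.comp (adj₃ D)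

theorem totalDegLE_embed {P : Series3 F V} {d : ℤ} (h : Deg3LE P d) :
    TotalDegLE (embed D P) d := totalDegLE_expandML (h.adj₃ D)

theorem pure3_add_left (f f' g h : LaurentSeries V) :
    pure3 F (f + f') g h = pure3 F f g h + pure3 F f' g h := series3_ext fun m n p => by
  simp only [series3_add_coe, pure3_coe, lc_add]
  ring

theorem pure3_add_mid (f g g' h : LaurentSeries V) :
    pure3 F f (g + g') h = pure3 F f g h + pure3 F f g' h := series3_ext fun m n p => by
  simp only [series3_add_coe, pure3_coe, lc_add]
  ring

theorem tens_add_left (f f' g : LaurentSeries V) : tens (f + f') g = tens f g + tens f' g :=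
  lc_ext fun j => by rw [lc_add, lc_tens, lc_tens, lc_tens, smul_add]

/-- Additive maps into iterated Laurent series agree if they agree on monomials and do not raise
the total degree too much. -/
theorem hom_ext_of_totalDeg {Φ Ψ : LaurentSeries V →+ LaurentSeries (LaurentSeries V)}
    (hm : ∀ n a, Φ (mono n a) = Ψ (mono n a)) (c : ℤ)
    (hΦ : ∀ A N, DegLE A N → TotalDegLE (Φ A) (N + c))
    (hΨ : ∀ A N, DegLE A N → TotalDegLE (Ψ A) (N + c)) (A : LaurentSeries V) : Φ A = Ψ A :=
  lc_ext fun j => lc_ext fun i => by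
    have := hom_ext_of_low (Φ := ((lcHom i).comp (lcHom j)).comp Φ)
      (Ψ := ((lcHom i).comp (lcHom j)).comp Ψ)
      (fun n a => by simp [hm]) (i + j - c - 1) (fun A hA => by
        simp only [AddMonoidHom.comp_apply, lcHom_apply]
        rw [hΦ A _ hA j i (by omega), hΨ A _ hA j i (by omega)])
    exact DFunLike.congr_fun this A

theorem embed_pure3 (f g B : LaurentSeries V) :
    embed D (pure3 F f g B) = actXY D (adj (dHom D) B) (tens f g) := by
  obtain ⟨b, hb⟩ := exists_degLE B
  have h0 : ∀ m n B, embed D (pure3 F (mono m 1) (mono n 1) B) =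
      actXY D (adj (dHom D) B) (tens (mono m 1) (mono n 1)) := fun m n B => by
    rw [embed, AddMonoidHom.comp_apply, adj₃_pure3, expandML_pure3 D]
  -- A coefficient v is moved into the third factor, where the adjoint turns multiplication by v
  -- into composition with v on the right, that is, into the action on v.
  have h1 : ∀ m n v, embed D (pure3 F (mono m v) (mono n 1) B) =
      actXY D (adj (dHom D) B) (tens (mono m v) (mono n 1)) := fun m n v => by
    have e1 : pure3 F (mono m v) (mono n 1) B = pure3 F (mono m 1) (mono n 1) (v • B) :=
      series3_ext fun i j p => by
        simp only [pure3_coe, lc_mono, lc_smul_left]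
        split_ifs <;> ring
    have e2 : tens (mono m v) (mono n 1) =
        actXY D (mono 0 v) (tens (mono m 1) (mono n (1 : V))) := lc_ext fun j => lc_ext fun i => by
      rw [actXY_mono_zero, lc_mapHom, smulAddHom_apply, lc_smul_left, lc_lc_tens, lc_lc_tens]
      simp only [lc_mono]
      split_ifs <;> ring
    have e3 : adj (dHom D) (v • B) = comp D (adj (dHom D) B) (mono 0 v) := by
      rw [← mapHom_mul, adj_star_mono_zero (dHom_mul D), mul_flip, comp_eq_star]
    rw [e1, h0, e2, ← actXY_comp, e3]
  have h2 : ∀ f n, embed D (pure3 F f (mono n 1) B) =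
      actXY D (adj (dHom D) B) (tens f (mono n 1)) := fun f n => by
    refine hom_ext_of_totalDeg
      (Φ := (embed D).comp (AddMonoidHom.mk' (fun f => pure3 F f (mono n 1) B)
        fun f f' => pure3_add_left f f' _ _))
      (Ψ := (actXY D (adj (dHom D) B)).comp (AddMonoidHom.mk' (fun f => tens f (mono n 1))
        fun f f' => tens_add_left f f' _))
      (fun m v => h1 m n v) (n + b)
      (fun A N hA => ?_) (fun A N hA => ?_) f
    · rw [← add_assoc]
      exact totalDegLE_embed D (degLE_pure3 hA (degLE_mono n 1) hb)
    · rw [← add_assoc]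
      exact TotalDegLE.actXY D (hb.adj _) (totalDegLE_tens hA (degLE_mono n 1))
  obtain ⟨a, ha⟩ := exists_degLE f
  refine hom_ext_of_totalDeg
    (Φ := (embed D).comp (AddMonoidHom.mk' (fun g => pure3 F f g B)
      fun g g' => pure3_add_mid f g g' _))
    (Ψ := (actXY D (adj (dHom D) B)).comp (tens f))
    (fun n v => ?_) (a + b)
    (fun A N hA => ?_) (fun A N hA => ?_) g
  · have e1 : pure3 F f (mono n v) B = pure3 F (v • f) (mono n 1) B :=
      series3_ext fun i j p => by
        simp only [pure3_coe, lc_mono, lc_smul_left]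
        split_ifs <;> ring
    have e2 : tens f (mono n v) = tens (v • f) (mono n 1) := lc_ext fun j => by
      simp only [lc_tens, lc_mono]
      split_ifs <;> simp
    simp only [AddMonoidHom.comp_apply, AddMonoidHom.mk'_apply, e1, e2, h2]
  · rw [← add_assoc, add_comm N a]
    exact totalDegLE_embed D (degLE_pure3 ha hA hb)
  · rw [← add_assoc, add_comm N a]
    exact TotalDegLE.actXY D (hb.adj _) (totalDegLE_tens ha hA)

/-- Additive maps into iterated Laurent series agree if they agree on the products
`λ₁ ^ m * λ₂ ^ n * B(λ₃)` and do not raise the total degree too much. -/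
theorem series3_hom_ext_of_totalDeg {Φ Ψ : Series3 F V →+ LaurentSeries (LaurentSeries V)}
    (hp : ∀ m n B, Φ (pure3 F (mono m 1) (mono n 1) B) = Ψ (pure3 F (mono m 1) (mono n 1) B))
    (c : ℤ) (hΦ : ∀ (P : Series3 F V) d, Deg3LE P d → TotalDegLE (Φ P) (d + c))
    (hΨ : ∀ (P : Series3 F V) d, Deg3LE P d → TotalDegLE (Ψ P) (d + c)) (P : Series3 F V) :
    Φ P = Ψ P := lc_ext fun j => lc_ext fun i => by
  have := series3_hom_ext (Φ := ((lcHom i).comp (lcHom j)).comp Φ)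
    (Ψ := ((lcHom i).comp (lcHom j)).comp Ψ) (fun m n B => by simp [hp]) (i + j - c - 1)
    (fun P hP => by
      simp only [AddMonoidHom.comp_apply, lcHom_apply]
      rw [hΦ P _ hP j i (by omega), hΨ P _ hP j i (by omega)])
  exact DFunLike.congr_fun this P

theorem embed_right₁ (A : LaurentSeries V) (P : Series3 F V) :
    embed D (right₁ D A P) = rightX D A (embed D P) := by
  obtain ⟨a, ha⟩ := exists_degLE A
  refine series3_hom_ext_of_totalDeg (Φ := (embed D).comp (right₁ D A))
    (Ψ := (rightX D A).comp (embed D)) (fun m n B => ?_) a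
    (fun P d hP => totalDegLE_embed D (hP.right₁ D ha))
    (fun P d hP => TotalDegLE.rightX D ha (totalDegLE_embed D hP)) P
  simp only [AddMonoidHom.comp_apply, right₁_pure3, embed_pure3, rightX_actXY, rightX_tens]

theorem embed_right₂ (A : LaurentSeries V) (P : Series3 F V) :
    embed D (right₂ D A P) = rightY D A (embed D P) := by
  obtain ⟨a, ha⟩ := exists_degLE A
  refine series3_hom_ext_of_totalDeg (Φ := (embed D).comp (right₂ D A))
    (Ψ := (rightY D A).comp (embed D)) (fun m n B => ?_) a
    (fun P d hP => totalDegLE_embed D (hP.right₂ D ha))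
    (fun P d hP => TotalDegLE.rightY D ha (totalDegLE_embed D hP)) P
  simp only [AddMonoidHom.comp_apply, right₂_pure3, embed_pure3, rightY_actXY, rightY_tens]

/-- As λ₃ stands for -x - y - ∂, composing on the right in λ₃ becomes, after the adjoint reverses
the order, an action of the adjoint of A on the left. -/
theorem embed_right₃ (A : LaurentSeries V) (P : Series3 F V) :
    embed D (right₃ D A P) = actXY D (negShift D A) (embed D P) := by
  obtain ⟨a, ha⟩ := exists_degLE A
  refine series3_hom_ext_of_totalDeg (Φ := (embed D).comp (right₃ D A))
    (Ψ := (actXY D (negShift D A)).comp (embed D)) (fun m n B => ?_) a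
    (fun P d hP => totalDegLE_embed D (hP.right₃ D ha))
    (fun P d hP => TotalDegLE.actXY D (by rw [negShift_eq_adj]; exact ha.adj _)
      (totalDegLE_embed D hP)) P
  simp only [AddMonoidHom.comp_apply, right₃_pure3, embed_pure3, ← actXY_comp,
    ← negShift_eq_adj, negShift_comp]

theorem iotaML_adj₃ (P : Series3 F V) (i j : ℤ) :
    iotaML F V (Submodule.Quotient.mk (adj₃ D P)) i j = lc (lc (embed D P) j) i :=
  (lc_lc_expandML _ _ _).symm

theorem iotaLM_adj₃ (P : Series3 F V) (i j : ℤ) :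
    iotaLM F V (Submodule.Quotient.mk (adj₃ D P)) i j = lc (lc (embed D (swap P)) j) i := by
  rw [iotaLM_mk, swap_adj₃, iotaML_adj₃]

theorem adj_iterate_del (k : ℕ) (B : LaurentSeries V) :
    adj (dHom D) ((del (dHom D))^[k] B) = sgn k • shift k (adj (dHom D) B) := by
  rw [← adj_powT]
  congr 1
  induction k with
  | zero => simp
  | succ k ih =>
    rw [Function.iterate_succ_apply', ih]
    push_cast
    rw [powT_succ]

theorem mapHom_one_smul (w : LaurentSeries (LaurentSeries V)) :
    mapHom (smulAddHom V (LaurentSeries V) 1) w = w := lc_ext fun n => by simp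

theorem sgn_sub (n : ℤ) (k : ℤ) : sgn (n - k) = sgn n * sgn k := by
  unfold sgn
  rw [Int.negOnePow_sub, Units.val_mul]

/-- After `cyc` the inner variable x is λ₃ and y is λ₁, so `embed` eliminates λ₂, just as ι_{λ,λ+μ}
eliminates μ; the adjoint in x then returns from λ₃ to ν. -/
theorem iotaLN_adj₃ (P : Series3 F V) (i j : ℤ) :
    iotaLN F V (Submodule.Quotient.mk (adj₃ D P)) i j =
      lc (adj (dHom D) (lc (embed D (cyc P)) j)) i := by
  refine DFunLike.congr_fun (series3_hom_ext
    (Φ := AddMonoidHom.mk' (fun P => iotaLN F V (Submodule.Quotient.mk (adj₃ D P)) i j)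
      fun P Q => by rw [map_add, Submodule.Quotient.mk_add, map_add]; rfl)
    (Ψ := (((lcHom i).comp (adj (dHom D))).comp (lcHom j)).comp ((embed D).comp cyc))
    (fun m n B => ?_) (i + j - 1) (fun P hP => ?_)) P
  · simp only [AddMonoidHom.mk'_apply, AddMonoidHom.comp_apply, lcHom_apply, cyc_pure3, embed_pure3,
      adj₃_pure3, adj_mono, powT_mono_of_eq_zero (dHom D) n (show dHom D 1 = 0 by simp)]
    have e1 : actXY D (sgn n • mono (0 + n) 1) (tens B (mono m 1)) =
        sgn n • powT (del (dHom D)) n (tens B (mono m 1)) := by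
      rw [actXY, map_zsmul, AddMonoidHom.zsmul_apply, zero_add, star_mono_left, mapHom_one_smul]
    have e2 := map_finsum_of_powT ((lcHom i).comp (adj (dHom D))) (del (dHom D)) n
      (tens B (mono m 1)) j
    simp only [AddMonoidHom.comp_apply, lcHom_apply] at e2
    rw [e1, lc_smul', map_zsmul, lc_smul', lc_powT, e2, sgn_smul_finsum, iotaLN_mk,
      binomSum_of_single n]
    · refine finsum_congr fun k => ?_
      rw [pure3_coe, lc_mono_same, lc_tens, smul_comm (sgn n)]
      congr 1
      by_cases h : j - n + k = m
      · rw [h, lc_mono_same, one_smul, adj_iterate_del, lc_smul', lc_shift, smul_smul, sgn_sub,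
          one_mul, one_mul]
      · rw [lc_mono_of_ne h, zero_smul, iterate_del_zero, map_zero]
        simp
    · intro q k hq
      rw [pure3_coe, lc_mono_of_ne hq]
      simp
  · simp only [AddMonoidHom.mk'_apply, AddMonoidHom.comp_apply, lcHom_apply]
    rw [(totalDegLE_embed D hP.cyc j).adj _ i (by omega), iotaLN_mk]
    refine binomSum_eq_zero fun q k => ?_
    rw [hP.adj₃ D _ _ _ (by omega), smul_zero]

end Embeddings

/-! ### Families of series indexed by triples of elements -/

section Projections

variable {F : Type*} [Field F] {V : Type*} [CommRing V] [Algebra F V] (D : Derivation F V V)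
  {m : ℕ} (θ : Fin m → V) (U : V → Fin m → LaurentSeries V)

/-- The Dirac modification in the first argument. -/
noncomputable def proj₁ (w : V → V → V → Series3 F V) : V → V → V → Series3 F V := fun a b c =>
  w a b c - ∑ β, right₁ D (U a β) (w (θ β) b c)

/-- The Dirac modification in the second argument. -/
noncomputable def proj₂ (w : V → V → V → Series3 F V) : V → V → V → Series3 F V := fun a b c =>
  w a b c - ∑ β, right₂ D (U b β) (w a (θ β) c)

/-- The Dirac modification in the third argument. -/
noncomputable def proj₃ (w : V → V → V → Series3 F V) : V → V → V → Series3 F V := fun a b c =>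
  w a b c - ∑ β, right₃ D (U c β) (w a b (θ β))

theorem proj₁_proj₂ (w : V → V → V → Series3 F V) :
    proj₁ D θ U (proj₂ D θ U w) = proj₂ D θ U (proj₁ D θ U w) := by
  funext a b c
  simp only [proj₁, proj₂, map_sub, map_sum, Finset.sum_sub_distrib, right₁_right₂]
  rw [Finset.sum_comm]
  abel

theorem proj₂_proj₃ (w : V → V → V → Series3 F V) :
    proj₂ D θ U (proj₃ D θ U w) = proj₃ D θ U (proj₂ D θ U w) := by
  funext a b c
  simp only [proj₂, proj₃, map_sub, map_sum, Finset.sum_sub_distrib, right₂_right₃]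
  rw [Finset.sum_comm]
  abel

theorem proj₃_proj₁ (w : V → V → V → Series3 F V) :
    proj₃ D θ U (proj₁ D θ U w) = proj₁ D θ U (proj₃ D θ U w) := by
  funext a b c
  simp only [proj₃, proj₁, map_sub, map_sum, Finset.sum_sub_distrib, right₃_right₁]
  rw [Finset.sum_comm]
  abel

/-- The Dirac modification in all three arguments. -/
noncomputable def proj (w : V → V → V → Series3 F V) : V → V → V → Series3 F V :=
  proj₁ D θ U (proj₃ D θ U (proj₂ D θ U w))

theorem proj_sub (w w' : V → V → V → Series3 F V) :
    proj D θ U (fun a b c => w a b c - w' a b c) =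
      fun a b c => proj D θ U w a b c - proj D θ U w' a b c := by
  have h₁ : ∀ w w' : V → V → V → Series3 F V, proj₁ D θ U (fun a b c => w a b c - w' a b c) =
      fun a b c => proj₁ D θ U w a b c - proj₁ D θ U w' a b c := fun w w' => by
    funext a b c
    simp only [proj₁, map_sub, Finset.sum_sub_distrib]
    abel
  have h₂ : ∀ w w' : V → V → V → Series3 F V, proj₂ D θ U (fun a b c => w a b c - w' a b c) =
      fun a b c => proj₂ D θ U w a b c - proj₂ D θ U w' a b c := fun w w' => by
    funext a b c
    simp only [proj₂, map_sub, Finset.sum_sub_distrib]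
    abel
  have h₃ : ∀ w w' : V → V → V → Series3 F V, proj₃ D θ U (fun a b c => w a b c - w' a b c) =
      fun a b c => proj₃ D θ U w a b c - proj₃ D θ U w' a b c := fun w w' => by
    funext a b c
    simp only [proj₃, map_sub, Finset.sum_sub_distrib]
    abel
  rw [proj, h₂, h₃, h₁]
  rfl

theorem proj_momentum (w : V → V → V → Series3 F V) :
    proj D θ U (fun a b c => momentum D (w a b c)) =
      fun a b c => momentum D (proj D θ U w a b c) := by
  have h₁ : ∀ w : V → V → V → Series3 F V, proj₁ D θ U (fun a b c => momentum D (w a b c)) =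
      fun a b c => momentum D (proj₁ D θ U w a b c) := fun w => by
    funext a b c
    simp only [proj₁, map_sub, map_sum, right₁_momentum]
  have h₂ : ∀ w : V → V → V → Series3 F V, proj₂ D θ U (fun a b c => momentum D (w a b c)) =
      fun a b c => momentum D (proj₂ D θ U w a b c) := fun w => by
    funext a b c
    simp only [proj₂, map_sub, map_sum, right₂_momentum]
  have h₃ : ∀ w : V → V → V → Series3 F V, proj₃ D θ U (fun a b c => momentum D (w a b c)) =
      fun a b c => momentum D (proj₃ D θ U w a b c) := fun w => by
    funext a b c
    simp only [proj₃, map_sub, map_sum, right₃_momentum]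
  rw [proj, h₂, h₃, h₁]
  rfl

/-- Exchanging arguments together with variables exchanges `proj₁` and `proj₂`, and the three
modifications commute. -/
theorem proj_swap (w : V → V → V → Series3 F V) :
    proj D θ U (fun b a c => swap (w a b c)) = fun b a c => swap (proj D θ U w a b c) := by
  have h₁ : ∀ w : V → V → V → Series3 F V, proj₁ D θ U (fun b a c => swap (w a b c)) =
      fun b a c => swap (proj₂ D θ U w a b c) := fun w => by
    funext a b c
    simp only [proj₁, proj₂, map_sub, map_sum, swap_right₂]
  have h₂ : ∀ w : V → V → V → Series3 F V, proj₂ D θ U (fun b a c => swap (w a b c)) =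
      fun b a c => swap (proj₁ D θ U w a b c) := fun w => by
    funext a b c
    simp only [proj₁, proj₂, map_sub, map_sum, swap_right₁]
  have h₃ : ∀ w : V → V → V → Series3 F V, proj₃ D θ U (fun b a c => swap (w a b c)) =
      fun b a c => swap (proj₃ D θ U w a b c) := fun w => by
    funext a b c
    simp only [proj₃, map_sub, map_sum, swap_right₃]
  rw [proj, h₂, h₃, h₁, proj₃_proj₁, ← proj₁_proj₂, proj₂_proj₃]
  rfl

/-- The same for a cyclic permutation; the sign is the one in {{a b} c} ↦ -{c {a b}}. -/
theorem proj_neg_cyc (w : V → V → V → Series3 F V) :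
    proj D θ U (fun c a b => -cyc (w a b c)) = fun c a b => -cyc (proj D θ U w a b c) := by
  have h₁ : ∀ w : V → V → V → Series3 F V, proj₁ D θ U (fun c a b => -cyc (w a b c)) =
      fun c a b => -cyc (proj₃ D θ U w a b c) := fun w => by
    funext c a b
    simp only [proj₁, proj₃, map_sub, map_sum, map_neg, cyc_right₃, Finset.sum_neg_distrib]
    abel
  have h₂ : ∀ w : V → V → V → Series3 F V, proj₂ D θ U (fun c a b => -cyc (w a b c)) =
      fun c a b => -cyc (proj₁ D θ U w a b c) := fun w => by
    funext c a b
    simp only [proj₁, proj₂, map_sub, map_sum, map_neg, cyc_right₁, Finset.sum_neg_distrib]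
    abel
  have h₃ : ∀ w : V → V → V → Series3 F V, proj₃ D θ U (fun c a b => -cyc (w a b c)) =
      fun c a b => -cyc (proj₂ D θ U w a b c) := fun w => by
    funext c a b
    simp only [proj₂, proj₃, map_sub, map_sum, map_neg, cyc_right₂, Finset.sum_neg_distrib]
    abel
  rw [proj, h₂, h₃, h₁, ← proj₁_proj₂, proj₃_proj₁]
  rfl

theorem exists_mk_adj₃ (x : VLM F V) :
    ∃ P : Series3 F V, (Submodule.Quotient.mk (adj₃ D P) : VLM F V) = x := by
  obtain ⟨Q, rfl⟩ := Submodule.Quotient.mk_surjective _ x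
  exact ⟨adj₃ D Q, by rw [adj₃_adj₃]⟩

/-- `adj₃` is an involution that exchanges `momentum` and `relMul` up to sign. -/
theorem mk_adj₃_eq_zero_iff (P : Series3 F V) :
    (Submodule.Quotient.mk (adj₃ D P) : VLM F V) = 0 ↔ ∃ Q, P = momentum D Q := by
  rw [Submodule.Quotient.mk_eq_zero, LinearMap.mem_range]
  constructor
  · rintro ⟨S, hS⟩
    refine ⟨-adj₃ D S, ?_⟩
    have h := congrArg (adj₃ D) (adj₃_momentum D (adj₃ D S))
    rw [adj₃_adj₃, adj₃_adj₃, hS, map_neg, adj₃_adj₃] at h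
    rw [map_neg, h, neg_neg]
  · rintro ⟨Q, rfl⟩
    refine ⟨-adj₃ D Q, ?_⟩
    rw [adj₃_momentum, map_neg]

end Projections

/-! ### The Dirac modification of a bracket -/

section Dirac

variable {F : Type*} [Field F] {V : Type*} [CommRing V] [Algebra F V] {D : Derivation F V V}
  {br : LamBracket F V}

/-- The map `{a _λ ·}` as an additive map. -/
def bracketHom (br : LamBracket F V) (a : V) : V →+ LaurentSeries V := (br a).toAddMonoidHom

@[simp] theorem bracketHom_apply (a b : V) : bracketHom br a b = br a b := rfl

theorem iterCoeff_eq (a : V) (G : LaurentSeries V) (i j : ℤ) :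
    iterCoeff (br a) G i j = lc (lc (mapHom (bracketHom br a) G) j) i := rfl

theorem IsPVA.del_right (h : IsPVA D br) (a b : V) : br a (D b) = del (dHom D) (br a b) := by
  rw [h.sesqui_right, lamMul_eq_shift]
  rfl

theorem IsPVA.iterate_right (h : IsPVA D br) (k : ℕ) (a b : V) :
    br a ((dHom D)^[k] b) = (del (dHom D))^[k] (br a b) := by
  induction k with
  | zero => rfl
  | succ k ih =>
    rw [Function.iterate_succ_apply', Function.iterate_succ_apply', dHom_apply, h.del_right, ih]

theorem IsPVA.negShift_bracket (h : IsPVA D br) (a b : V) : negShift D (br a b) = -br b a := by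
  rw [h.skew a b, neg_neg]

/-- The left Leibniz rule is applied to each product p_n ∂ ^ k q_l of coefficients, and
sesquilinearity turns ∂ ^ k inside the bracket into (x + ∂) ^ k. -/
theorem IsPVA.bracket_comp (h : IsPVA D br) (a : V) (P Q : LaurentSeries V) :
    mapHom (bracketHom br a) (comp D P Q) =
      rightY D Q (mapHom (bracketHom br a) P) + actXY D P (mapHom (bracketHom br a) Q) :=
  lc_ext fun j => by
    rw [lc_add, rightY, AddMonoidHom.flip_apply, actXY, lc_star, lc_star,
      ← binomSum_add (star_bddFamily _ _ _ _ _) (star_bddFamily _ _ _ _ _), comp_eq_star,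
      lc_mapHom, lc_star, map_binomSum _ (star_bddFamily _ _ _ _ _)]
    congr 1
    funext n k
    simp only [AddMonoidHom.mul_apply, bracketHom_apply, h.leibniz_left, h.iterate_right,
      AddMonoidHom.flip_apply, smulAddHom_apply, lc_mapHom]
    abel

variable {m : ℕ} {θ : Fin m → V} {K : Matrix (Fin m) (Fin m) (LaurentSeries V)}

/-- The series `∑_α K_{βα}(λ + ∂) {a _λ θ_α}`. -/
noncomputable def multiplier (D : Derivation F V V) (br : LamBracket F V) (θ : Fin m → V)
    (K : Matrix (Fin m) (Fin m) (LaurentSeries V)) (a : V) (β : Fin m) : LaurentSeries V :=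
  ∑ α, comp D (K β α) (br a (θ α))

theorem diracModification_eq (a b : V) : diracModification D br θ K a b =
    br a b - ∑ β, comp D (br (θ β) b) (multiplier D br θ K a β) := by
  simp only [multiplier, map_sum]
  rw [Finset.sum_comm]
  rfl

theorem constraintMatrix_apply (α β : Fin m) : constraintMatrix br θ α β = br (θ β) (θ α) := rfl

theorem sum_comp_comp {A B : Fin m → LaurentSeries V} {X : LaurentSeries V} :
    ∑ i, comp D (A i) (comp D (B i) X) = comp D (∑ i, comp D (A i) (B i)) X := by
  simp only [map_sum, LinearMap.sum_apply, comp_assoc]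

theorem sum_comp_ite (X : Fin m → LaurentSeries V) (i : Fin m) :
    ∑ j, comp D (if i = j then 1 else 0) (X j) = X i := by
  rw [Finset.sum_eq_single i]
  · simp [comp_one_left]
  · intro j _ hj
    simp [hj.symm]
  · simp

theorem sum_comp_ite' (X : Fin m → LaurentSeries V) (i : Fin m) :
    ∑ j, comp D (X j) (if j = i then 1 else 0) = X i := by
  rw [Finset.sum_eq_single i]
  · simp [comp_one_right]
  · intro j _ hj
    simp [hj]
  · simp

/-- The multiplier is the solution U of C(∂) U = {a θ}. This equation makes the θ_i central for the
modified bracket and allows U to be differentiated implicitly. -/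
theorem sum_comp_multiplier (hK : IsInverse D (constraintMatrix br θ) K) (a : V) (δ : Fin m) :
    ∑ β, comp D (br (θ β) (θ δ)) (multiplier D br θ K a β) = br a (θ δ) := by
  have h := hK.1 δ
  simp only [constraintMatrix_apply] at h
  simp only [multiplier, map_sum]
  rw [Finset.sum_comm]
  simp only [sum_comp_comp, h]
  exact sum_comp_ite _ δ

theorem negShift_sum (s : Finset (Fin m)) (f : Fin m → LaurentSeries V) :
    negShift D (∑ i ∈ s, f i) = ∑ i ∈ s, negShift D (f i) := by
  simp only [negShift_eq_adj, map_sum]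

/-- Skewsymmetry of the bracket says that C is skewadjoint, so minus the adjoint of K is a left
inverse of C (`h1`). It equals K because a left inverse agrees with a right inverse: (-K*) C K is
computed in two ways. -/
theorem IsPVA.negShift_inverse (hbr : IsPVA D br) (hK : IsInverse D (constraintMatrix br θ) K)
    (α β : Fin m) : negShift D (K α β) = -K β α := by
  have nite : ∀ p : Prop, [Decidable p] →
      negShift D (if p then 1 else 0) = if p then 1 else 0 := fun p _ => by
    rw [negShift_eq_adj]
    split_ifs
    · exact adj_mono_zero _ _
    · exact map_zero _
  have h1 : ∀ i j, ∑ l, comp D (-negShift D (K l j)) (constraintMatrix br θ l i) =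
      if j = i then 1 else 0 := fun i j => by
    have h := congrArg (negShift D) (hK.1 i j)
    rw [negShift_sum, nite] at h
    simp only [negShift_comp, constraintMatrix_apply, hbr.negShift_bracket] at h
    simp only [eq_comm (a := j), ← h, constraintMatrix_apply]
    simp
  have h2 : ∑ i, comp D (∑ l, comp D (-negShift D (K l β)) (constraintMatrix br θ l i)) (K i α) =
      K β α := by
    simp only [h1]
    exact sum_comp_ite (fun i => K i α) β
  have h3 : ∑ i, comp D (∑ l, comp D (-negShift D (K l β)) (constraintMatrix br θ l i)) (K i α) =
      -negShift D (K α β) := by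
    simp only [← sum_comp_comp]
    rw [Finset.sum_comm]
    simp only [← map_sum, hK.1]
    exact sum_comp_ite' (fun l => -negShift D (K l β)) α
  rw [← h2, h3, neg_neg]

theorem negShift_sub (A B : LaurentSeries V) :
    negShift D (A - B) = negShift D A - negShift D B := by
  simp only [negShift_eq_adj, map_sub]

theorem negShift_neg (A : LaurentSeries V) : negShift D (-A) = -negShift D A := by
  simp only [negShift_eq_adj, map_neg]

/-- The factors K and {c θ} are both skew under the adjoint, and their signs cancel. -/
theorem IsPVA.negShift_multiplier (hbr : IsPVA D br) (hK : IsInverse D (constraintMatrix br θ) K)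
    (c : V) (δ : Fin m) : negShift D (multiplier D br θ K c δ) =
      ∑ γ, comp D (br (θ γ) c) (K γ δ) := by
  rw [multiplier, negShift_sum]
  refine Finset.sum_congr rfl fun γ _ => ?_
  rw [negShift_comp, hbr.negShift_inverse hK, hbr.negShift_bracket]
  simp

/-- Cramer-free solution of a linear system: K is a left inverse of C and `actXY` is a module
action. -/
theorem actXY_sum_solve (hK : IsInverse D (constraintMatrix br θ) K)
    (y z : Fin m → LaurentSeries (LaurentSeries V))
    (h : ∀ δ, ∑ γ, actXY D (constraintMatrix br θ δ γ) (y γ) = z δ) (γ : Fin m) :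
    y γ = ∑ δ, actXY D (K γ δ) (z δ) := by
  simp only [← h, map_sum, ← actXY_comp]
  rw [Finset.sum_comm]
  simp only [← actXY_sum, hK.2]
  rw [Finset.sum_eq_single γ]
  · simp [actXY_one]
  · intro δ _ hδ
    simp [hδ.symm, actXY_zero]
  · simp

/-- If `w` lifts `{a _λ {b _μ c}}`, then its Dirac modification in all arguments lifts the iterated
modified bracket. -/
theorem IsPVA.embed_proj (hbr : IsPVA D br) (hK : IsInverse D (constraintMatrix br θ) K)
    (w : V → V → V → Series3 F V)
    (hw : ∀ a b c, embed D (w a b c) = mapHom (bracketHom br a) (br b c)) (a b c : V) :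
    embed D (proj D θ (multiplier D br θ K) w a b c) =
      mapHom (bracketHom (diracModification D br θ K) a) (diracModification D br θ K b c) := by
  set U := multiplier D br θ K with hU
  have e2 : ∀ a b c, embed D (proj₂ D θ U w a b c) = mapHom (bracketHom br a) (br b c) -
      ∑ γ, rightY D (U b γ) (mapHom (bracketHom br a) (br (θ γ) c)) := fun a b c => by
    simp only [proj₂, map_sub, map_sum, embed_right₂, hw]
  -- Implicit differentiation: applying {a ·} to C U_b = {b θ_δ} gives C {a U_b} plus the terms in
  -- {a C}. Moved to the other side, those terms are the modification in the second argument.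
  have solve : ∀ a b γ, mapHom (bracketHom br a) (U b γ) =
      ∑ δ, actXY D (K γ δ) (embed D (proj₂ D θ U w a b (θ δ))) := fun a b => by
    refine actXY_sum_solve hK _ _ fun δ => ?_
    have h := congrArg (mapHom (bracketHom br a)) (sum_comp_multiplier hK b δ)
    rw [map_sum] at h
    simp only [hbr.bracket_comp, Finset.sum_add_distrib] at h
    rw [e2, ← h, add_sub_cancel_left]
    rfl
  -- Besides `e2`, the Leibniz rule leaves Σ_γ {θ_γ c} acting on {a U_b(γ)}. After `solve`, Σ_γ {θ_γ
  -- c} ∘ K_{γδ} is the adjoint of U_c(δ), and its action is `right₃` of U_c(δ).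
  have e3 : ∀ a b c, embed D (proj₃ D θ U (proj₂ D θ U w) a b c) =
      mapHom (bracketHom br a) (diracModification D br θ K b c) := fun a b c => by
    rw [diracModification_eq, map_sub, map_sum]
    simp only [hbr.bracket_comp, Finset.sum_add_distrib]
    rw [← sub_sub, ← hU, ← e2]
    simp only [proj₃, map_sub, map_sum, embed_right₃, solve]
    simp only [hU, hbr.negShift_multiplier hK, actXY_sum, actXY_comp]
    rw [Finset.sum_comm]
  rw [proj, proj₁, map_sub, map_sum]
  simp only [embed_right₁, e3]
  -- The outer modification affects only the variable x, coefficient by coefficient in y.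
  refine lc_ext fun j => ?_
  rw [lc_sub, lc_sum]
  simp only [rightX, lc_mapHom, compRight_apply, bracketHom_apply]
  rw [diracModification_eq a]

end Dirac

/-! ### The modified bracket: PVA axioms, compatibility and the ideal of constraints. -/

section DiracPVA

variable {F : Type*} [Field F] {V : Type*} [CommRing V] [Algebra F V] {D : Derivation F V V}
  {br : LamBracket F V} {m : ℕ} {θ : Fin m → V} {K : Matrix (Fin m) (Fin m) (LaurentSeries V)}

theorem lamMul_sub (A B : LaurentSeries V) : lamMul (A - B) = lamMul A - lamMul B := by
  simp only [lamMul_eq_shift, map_sub]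

theorem lamMul_sum (s : Finset (Fin m)) (f : Fin m → LaurentSeries V) :
    lamMul (∑ i ∈ s, f i) = ∑ i ∈ s, lamMul (f i) := by
  simp only [lamMul_eq_shift, map_sum]

theorem IsPVA.multiplier_deriv (hbr : IsPVA D br) (a : V) (β : Fin m) :
    multiplier D br θ K (D a) β = -lamMul (multiplier D br θ K a β) := by
  simp only [multiplier, hbr.sesqui_left, map_neg, comp_lamMul_right, lamMul_sum,
    Finset.sum_neg_distrib]

theorem IsPVA.multiplier_mul (hbr : IsPVA D br) (a b : V) (β : Fin m) :
    multiplier D br θ K (a * b) β =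
      comp D (multiplier D br θ K a β) (HahnSeries.C b) +
        comp D (multiplier D br θ K b β) (HahnSeries.C a) := by
  simp only [multiplier, hbr.leibniz_right, map_add, Finset.sum_add_distrib, map_sum,
    LinearMap.sum_apply, comp_assoc]

/-- The correction {θ b} ∘ K ∘ {a θ} has three factors, each skew under the adjoint, which reverses
their order and thereby exchanges a and b. -/
theorem IsPVA.dirac_skew (hbr : IsPVA D br) (hK : IsInverse D (constraintMatrix br θ) K) (a b : V) :
    diracModification D br θ K b a = -negShift D (diracModification D br θ K a b) := by
  rw [diracModification_eq, diracModification_eq, negShift_sub, hbr.negShift_bracket, negShift_sum]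
  simp only [negShift_comp, hbr.negShift_multiplier hK, hbr.negShift_bracket, map_neg,
    Finset.sum_neg_distrib]
  rw [neg_sub, sub_neg_eq_add, neg_add_eq_sub]
  congr 1
  simp only [multiplier, map_sum, LinearMap.sum_apply, comp_assoc]
  rw [Finset.sum_comm]

theorem IsPVA.dirac_jacobi (hbr : IsPVA D br) (hK : IsInverse D (constraintMatrix br θ) K)
    (a b c : V) : ∃ x y z : VLM F V,
    iotaML F V x = iterCoeff (diracModification D br θ K a) (diracModification D br θ K b c) ∧
    iotaLM F V y = iterCoeff (diracModification D br θ K b) (diracModification D br θ K a c) ∧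
    iotaLN F V z = iterCoeff (fun v => diracModification D br θ K v c)
      (diracModification D br θ K a b) ∧
    x - y = z := by
  -- Lifts are chosen for all triples at once, because `proj` mixes the values at (a, b, c) with
  -- those at the θ_i.
  choose x y z hx hy hz hxyz using hbr.jacobi
  choose X hX using fun a b c => exists_mk_adj₃ D (x a b c)
  choose Y hY using fun a b c => exists_mk_adj₃ D (y a b c)
  choose Z hZ using fun a b c => exists_mk_adj₃ D (z a b c)
  have hXw : ∀ a b c, embed D (X a b c) = mapHom (bracketHom br a) (br b c) := fun a b c =>
    lc_ext fun j => lc_ext fun i => by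
      rw [← iotaML_adj₃, hX, hx, iterCoeff_eq]
  have hYw : ∀ b a c, embed D (swap (Y a b c)) = mapHom (bracketHom br b) (br a c) := fun b a c =>
    lc_ext fun j => lc_ext fun i => by
      rw [← iotaLM_adj₃, hY, hy, iterCoeff_eq]
  -- Skewsymmetry makes the third Jacobi term an iterated bracket as well, for the arguments (c, a,
  -- b), so that `IsPVA.embed_proj` applies to all three terms.
  have hZw : ∀ c a b, embed D (-cyc (Z a b c)) = mapHom (bracketHom br c) (br a b) := fun c a b =>
    lc_ext fun j => by
      have h : adj (dHom D) (lc (embed D (cyc (Z a b c))) j) = br (lc (br a b) j) c :=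
        lc_ext fun i => by
          rw [← iotaLN_adj₃, hZ, hz, iterCoeff]
      rw [map_neg, lc_neg, ← adj_adj (dHom D) (lc (embed D (cyc (Z a b c))) j), h, lc_mapHom,
        bracketHom_apply, ← negShift_eq_adj, hbr.negShift_bracket, neg_neg]
  set U := multiplier D br θ K with hU
  have hQ : ∀ a b c, ∃ Q, X a b c - Y a b c - Z a b c = momentum D Q := fun a b c => by
    rw [← mk_adj₃_eq_zero_iff, map_sub, map_sub, Submodule.Quotient.mk_sub,
      Submodule.Quotient.mk_sub, hX, hY, hZ, hxyz, sub_self]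
  choose Q hQ using hQ
  refine ⟨Submodule.Quotient.mk (adj₃ D (proj D θ U X a b c)),
    Submodule.Quotient.mk (adj₃ D (proj D θ U Y a b c)),
    Submodule.Quotient.mk (adj₃ D (proj D θ U Z a b c)), ?_, ?_, ?_, ?_⟩
  · funext i j
    rw [iotaML_adj₃, hbr.embed_proj hK X hXw, iterCoeff_eq]
  · funext i j
    have := hbr.embed_proj hK _ hYw b a c
    rw [proj_swap] at this
    rw [iotaLM_adj₃, this, iterCoeff_eq]
  · funext i j
    have h := hbr.embed_proj hK _ hZw c a b
    rw [proj_neg_cyc, map_neg, neg_eq_iff_eq_neg] at h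
    rw [iotaLN_adj₃, h, lc_neg, lc_mapHom, bracketHom_apply, ← negShift_eq_adj, negShift_neg,
      iterCoeff, ← hbr.dirac_skew hK]
  · rw [← sub_eq_zero, ← Submodule.Quotient.mk_sub, ← Submodule.Quotient.mk_sub, ← map_sub,
      ← map_sub, mk_adj₃_eq_zero_iff]
    -- X - Y - Z is the image of Q under λ₁ + λ₂ + λ₃ + ∂, which commutes with `proj`.
    refine ⟨proj D θ U Q a b c, ?_⟩
    have h := proj_momentum D θ U Q
    simp only [← hQ, proj_sub] at h
    exact congrFun (congrFun (congrFun h a) b) c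

/-- The Dirac modification of a PVA `λ`-bracket is a PVA `λ`-bracket. -/
theorem IsPVA.dirac (hbr : IsPVA D br) (hK : IsInverse D (constraintMatrix br θ) K) :
    IsPVA D (diracModification D br θ K) where
  sesqui_left a b := by
    simp only [diracModification_eq, hbr.sesqui_left, hbr.multiplier_deriv, map_neg,
      comp_lamMul_right, lamMul_sub, lamMul_sum, Finset.sum_neg_distrib]
    abel
  sesqui_right a b := by
    have h : ∀ A : LaurentSeries V, lamMul A + A.map D = del (dHom D) A := fun A => by
      rw [lamMul_eq_shift]
      rfl
    rw [h]
    simp only [diracModification_eq, hbr.del_right, map_sub, map_sum, del_comp]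
  leibniz_left a b c := by
    simp only [diracModification_eq, hbr.leibniz_left, map_add, LinearMap.add_apply, comp_smul_left,
      Finset.sum_add_distrib, smul_sub, Finset.smul_sum]
    abel
  leibniz_right a b c := by
    simp only [diracModification_eq, hbr.leibniz_right, hbr.multiplier_mul, map_add, map_sub,
      LinearMap.sub_apply, map_sum, LinearMap.sum_apply, comp_assoc, Finset.sum_add_distrib]
    abel
  skew := hbr.dirac_skew hK
  admissible a b c := by
    obtain ⟨x, _, _, hx, _⟩ := hbr.dirac_jacobi hK a b c
    exact ⟨x, hx⟩
  jacobi := hbr.dirac_jacobi hK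

theorem diracModification_constraint (hK : IsInverse D (constraintMatrix br θ) K) (a : V)
    (δ : Fin m) : diracModification D br θ K a (θ δ) = 0 := by
  rw [diracModification_eq, sum_comp_multiplier hK, sub_self]

theorem IsPVA.bracket_swap_eq_zero (hbr : IsPVA D br) {a b : V} (h : br a b = 0) : br b a = 0 := by
  rw [hbr.skew, h, negShift_eq_adj, map_zero, neg_zero]

/-- The first bracket vanishes on the θ_i on either side, so it contributes neither to the
constraint matrix of the pencil nor to the correction terms. -/
theorem Compatible.dirac {br₀ br₁ : LamBracket F V} (hcomp : Compatible D br₀ br₁)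
    (hcentral : ∀ i a, br₀ a (θ i) = 0) (hK : IsInverse D (constraintMatrix br₁ θ) K) :
    Compatible D br₀ (diracModification D br₁ θ K) where
  left := hcomp.left
  right := hcomp.right.dirac hK
  comb s t := by
    by_cases ht : t = 0
    -- Here tC is not invertible in general, but the modification drops out and the original pencil
    -- suffices.
    · have h := hcomp.comb s 0
      rw [zero_smul] at h
      rwa [ht, zero_smul]
    · have hC : ∀ α β, constraintMatrix (s • br₀ + t • br₁) θ α β =
          t • constraintMatrix br₁ θ α β := fun α β => by
        simp [constraintMatrix_apply, hcentral]
      have hK' : IsInverse D (constraintMatrix (s • br₀ + t • br₁) θ) (t⁻¹ • K) := by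
        constructor
        · intro α γ
          simp only [hC, Matrix.smul_apply, map_smul, LinearMap.smul_apply, smul_smul,
            inv_mul_cancel₀ ht, one_smul, hK.1]
        · intro α γ
          simp only [hC, Matrix.smul_apply, map_smul, LinearMap.smul_apply, smul_smul,
            mul_inv_cancel₀ ht, one_smul, hK.2]
      have hbr : s • br₀ + t • diracModification D br₁ θ K =
          diracModification D (s • br₀ + t • br₁) θ (t⁻¹ • K) := by
        refine LinearMap.ext fun a => LinearMap.ext fun b => ?_
        have h0 : ∀ β b, br₀ (θ β) b = 0 := fun β b =>
          hcomp.left.bracket_swap_eq_zero (hcentral β b)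
        simp only [LinearMap.add_apply, LinearMap.smul_apply, diracModification_eq, multiplier,
          Matrix.smul_apply, hcentral, h0, smul_zero, zero_add, map_smul, smul_smul,
          mul_inv_cancel₀ ht, one_smul, ← Finset.smul_sum, smul_sub]
        abel
      rw [hbr]
      exact (hcomp.comb s t).dirac hK'

theorem lc_negShift_mem {I : Ideal V} (hI : IsDiffIdeal D I) {A : LaurentSeries V}
    (hA : ∀ n, lc A n ∈ I) (n : ℤ) : lc (negShift D A) n ∈ I := by
  have hit : ∀ (k : ℕ) (a : V), a ∈ I → (dHom D)^[k] a ∈ I := fun k => by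
    induction k with
    | zero => exact fun a ha => ha
    | succ k ih => exact fun a ha => ih _ (hI a ha)
  rw [negShift_eq_adj, lc_adj]
  exact finsum_induction (· ∈ I) I.zero_mem (fun _ _ => I.add_mem)
    fun k => zsmul_mem (zsmul_mem (hit k _ (hA _)) _) _

/-- The differential ideal generated by central elements is a PVA ideal. -/
theorem IsPVA.isPVAIdeal_diffSpan (hbr : IsPVA D br) (hθ : ∀ i a, br a (θ i) = 0) :
    IsPVAIdeal D br (diffSpan D θ) := by
  set I := diffSpan D θ with hI
  have hd : IsDiffIdeal D I := diffSpan_isDiffIdeal D θ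
  -- The elements of I whose brackets stay in I form a differential ideal containing the θ_i, so
  -- minimality of I gives I ≤ J. Membership in I itself is needed for the term b {a c} of the
  -- Leibniz rule.
  let J : Ideal V :=
    { carrier := {b | b ∈ I ∧ ∀ a n, lc (br a b) n ∈ I}
      zero_mem' := ⟨I.zero_mem, fun a n => by
        rw [map_zero]
        exact I.zero_mem⟩
      add_mem' := fun {b b'} hb hb' => ⟨I.add_mem hb.1 hb'.1, fun a n => by
        rw [map_add, lc_add]
        exact I.add_mem (hb.2 a n) (hb'.2 a n)⟩
      smul_mem' := fun c b hb => ⟨I.mul_mem_left c hb.1, fun a n => by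
        rw [smul_eq_mul, hbr.leibniz_left, lc_add, lc_smul_left, lc_smul_left]
        exact I.add_mem (I.mul_mem_left _ (hb.2 a n)) (I.mul_mem_right _ hb.1)⟩ }
  have hθI : ∀ i, θ i ∈ I := fun i => by
    rw [hI, diffSpan, Submodule.mem_sInf]
    exact fun L hL => hL.2 i
  have hIJ : I ≤ J := by
    refine sInf_le ⟨fun b hb => ⟨hd b hb.1, fun a n => ?_⟩, fun i => ⟨hθI i, fun a n => ?_⟩⟩
    · rw [hbr.del_right, lc_del]
      exact I.add_mem (hb.2 a _) (hd _ (hb.2 a n))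
    · rw [hθ]
      exact I.zero_mem
  refine ⟨hd, fun a ha b n => ?_, fun a b hb n => (hIJ hb).2 a n⟩
  rw [hbr.skew b a, lc_neg]
  exact I.neg_mem (lc_negShift_mem hd ((hIJ ha).2 b) n)

end DiracPVA

/-! ### Induced brackets -/

section Quotients

variable {F : Type*} [Field F] {V W : Type*} [CommRing V] [Algebra F V] [CommRing W] [Algebra F W]
  {D : Derivation F V V} {E : Derivation F W W} {br : LamBracket F V} {br' : LamBracket F W}

/-- The map of series in three variables induced by a map of coefficients. -/
def mapSeries3 (π : V →ₐ[F] W) : Series3 F V →ₗ[F] Series3 F W where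
  toFun P := ⟨fun m n p => π (P.1 m n p), by
    obtain ⟨N, hN⟩ := P.2
    exact ⟨N, fun m n p h => by
      beta_reduce
      rw [hN m n p h, map_zero]⟩⟩
  map_add' P Q := series3_ext fun m n p => map_add π _ _
  map_smul' c P := series3_ext fun m n p => map_smul π c _

/-- The map of the spaces `V_{λ,μ}` induced by a map of coefficients. -/
def mapVLM (π : V →ₐ[F] W) : VLM F V →ₗ[F] VLM F W :=
  Submodule.mapQ _ _ (mapSeries3 π) (by
    rintro _ ⟨P, rfl⟩
    refine ⟨mapSeries3 π P, series3_ext fun m n p => ?_⟩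
    show π _ - π _ - π _ = π (_ - _ - _)
    rw [map_sub, map_sub])

theorem iotaML_mapVLM (π : V →ₐ[F] W) (x : VLM F V) (i j : ℤ) :
    iotaML F W (mapVLM π x) i j = π (iotaML F V x i j) := by
  obtain ⟨P, rfl⟩ := Submodule.Quotient.mk_surjective _ x
  obtain ⟨N, hN⟩ := P.2
  exact (map_binomSum (π : V →+* W).toAddMonoidHom (T := fun p k => P.1 (i - k) (j - p + k) p)
    ⟨N, j - N, fun p k h => by
      by_contra hc
      exact h (hN _ _ _ (by omega))⟩).symm

theorem iotaLM_mapVLM (π : V →ₐ[F] W) (x : VLM F V) (i j : ℤ) :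
    iotaLM F W (mapVLM π x) i j = π (iotaLM F V x i j) := by
  obtain ⟨P, rfl⟩ := Submodule.Quotient.mk_surjective _ x
  exact iotaML_mapVLM π (Submodule.Quotient.mk (swap P)) i j

theorem iotaLN_mapVLM (π : V →ₐ[F] W) (x : VLM F V) (i j : ℤ) :
    iotaLN F W (mapVLM π x) i j = π (iotaLN F V x i j) := by
  obtain ⟨P, rfl⟩ := Submodule.Quotient.mk_surjective _ x
  obtain ⟨N, hN⟩ := P.2
  rw [iotaLN_mk]
  refine Eq.trans ?_ (map_binomSum (π : V →+* W).toAddMonoidHom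
    (T := fun n k => sgn (n - k) • P.1 (j - n + k) n (i - k))
    ⟨N, j - N, fun p k h => by
      by_contra hc
      exact h (by
        beta_reduce
        rw [hN _ _ _ (by omega), smul_zero])⟩).symm
  refine (iotaLN_mk (mapSeries3 π P) i j).trans ?_
  congr 1
  funext n k
  exact (map_zsmul (π : V →+* W).toAddMonoidHom _ _).symm

/-- A bracket induced by a PVA `λ`-bracket along a surjective map of differential algebras is a PVA
`λ`-bracket. -/
theorem IsPVA.of_surjective (hbr : IsPVA D br) (π : V →ₐ[F] W) (hπ : Function.Surjective π)
    (hD : ∀ a, π (D a) = E (π a)) (hmap : ∀ a b, br' (π a) (π b) = (br a b).map π) :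
    IsPVA E br' := by
  set p : V →+ W := (π : V →+* W).toAddMonoidHom with hp
  have hm : ∀ a b, br' (π a) (π b) = mapHom p (br a b) := hmap
  have hlc : ∀ a b n, lc (br' (π a) (π b)) n = π (lc (br a b) n) := fun a b n => by
    rw [hm]
    rfl
  have hcomp : ∀ A B, mapHom p (comp D A B) = comp E (mapHom p A) (mapHom p B) := fun A B => by
    rw [comp_eq_star, comp_eq_star]
    exact star_natural p p p (fun a b => map_mul π a b) hD A B
  have hneg : ∀ A, mapHom p (negShift D A) = negShift E (mapHom p A) := fun A => by
    rw [negShift_eq_adj, negShift_eq_adj]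
    exact adj_natural p _ _ hD A
  have hlam : ∀ A, mapHom p (lamMul A) = lamMul (mapHom p A) := fun A => by
    rw [lamMul_eq_shift, lamMul_eq_shift]
    exact lc_ext fun n => by simp
  have hsmul : ∀ (a : V) (A : LaurentSeries V), mapHom p (a • A) = π a • mapHom p A := fun a A =>
    lc_ext fun n => map_mul π a _
  have hder : ∀ A : LaurentSeries V, mapHom p (A.map D) = (mapHom p A).map E := fun A =>
    lc_ext fun n => hD _
  have hC : ∀ a : V, mapHom p (HahnSeries.C a) = HahnSeries.C (π a) := fun a => mapHom_mono p 0 a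
  -- This comes first because its first witness also proves admissibility.
  have hjac : ∀ a b c, ∃ x y z : VLM F W,
      iotaML F W x = iterCoeff (br' a) (br' b c) ∧
      iotaLM F W y = iterCoeff (br' b) (br' a c) ∧
      iotaLN F W z = iterCoeff (fun v => br' v c) (br' a b) ∧
      x - y = z := by
    intro a b c
    obtain ⟨a, rfl⟩ := hπ a
    obtain ⟨b, rfl⟩ := hπ b
    obtain ⟨c, rfl⟩ := hπ c
    obtain ⟨x, y, z, hx, hy, hz, hxyz⟩ := hbr.jacobi a b c
    refine ⟨mapVLM π x, mapVLM π y, mapVLM π z, ?_, ?_, ?_, by rw [← map_sub, hxyz]⟩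
    · funext i j
      rw [iotaML_mapVLM, hx, iterCoeff, iterCoeff, hlc, hlc]
    · funext i j
      rw [iotaLM_mapVLM, hy, iterCoeff, iterCoeff, hlc, hlc]
    · funext i j
      rw [iotaLN_mapVLM, hz, iterCoeff, iterCoeff, hlc, hlc]
  refine ⟨fun a b => ?_, fun a b => ?_, fun a b c => ?_, fun a b c => ?_, fun a b => ?_,
    fun a b c => ?_, hjac⟩
  · obtain ⟨a, rfl⟩ := hπ a
    obtain ⟨b, rfl⟩ := hπ b
    rw [← hD, hm, hbr.sesqui_left, map_neg, hlam, hm]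
  · obtain ⟨a, rfl⟩ := hπ a
    obtain ⟨b, rfl⟩ := hπ b
    rw [← hD, hm, hbr.sesqui_right, map_add, hlam, hder, hm]
  · obtain ⟨a, rfl⟩ := hπ a
    obtain ⟨b, rfl⟩ := hπ b
    obtain ⟨c, rfl⟩ := hπ c
    rw [← map_mul, hm, hbr.leibniz_left, map_add, hsmul, hsmul, hm, hm]
  · obtain ⟨a, rfl⟩ := hπ a
    obtain ⟨b, rfl⟩ := hπ b
    obtain ⟨c, rfl⟩ := hπ c
    rw [← map_mul, hm, hbr.leibniz_right, map_add, hcomp, hcomp, hC, hC, hm, hm]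
  · obtain ⟨a, rfl⟩ := hπ a
    obtain ⟨b, rfl⟩ := hπ b
    rw [hm, hbr.skew, map_neg, hneg, hm]
  · obtain ⟨x, _, _, hx, _⟩ := hjac a b c
    exact ⟨x, hx⟩

theorem IsPVAIdeal.bracket_congr {I : Ideal V} (hI : IsPVAIdeal D br I) {a a' b b' : V}
    (ha : Ideal.Quotient.mk I a = Ideal.Quotient.mk I a')
    (hb : Ideal.Quotient.mk I b = Ideal.Quotient.mk I b') :
    (br a b).map (Ideal.Quotient.mk I) = (br a' b').map (Ideal.Quotient.mk I) :=
  lc_ext fun n => by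
    rw [Ideal.Quotient.eq] at ha hb
    show Ideal.Quotient.mk I (lc (br a b) n) = Ideal.Quotient.mk I (lc (br a' b') n)
    rw [Ideal.Quotient.eq]
    have h1 := hI.left _ ha b n
    have h2 := hI.right a' _ hb n
    rw [map_sub, LinearMap.sub_apply, lc_sub] at h1
    rw [map_sub, lc_sub] at h2
    have := I.add_mem h1 h2
    rwa [sub_add_sub_cancel] at this

/-- The bracket is computed on chosen representatives; independence of the choice gives both
bilinearity and the inducing property. -/
theorem IsPVAIdeal.exists_isInduced {I : Ideal V} (hI : IsPVAIdeal D br I) :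
    ∃ br' : LamBracket F (V ⧸ I), IsInduced I br br' := by
  have hout : ∀ x : V ⧸ I, Ideal.Quotient.mk I x.out = x := Ideal.Quotient.mk_out
  have hadd : ∀ A B : LaurentSeries V, (A + B).map (Ideal.Quotient.mk I) =
      A.map (Ideal.Quotient.mk I) + B.map (Ideal.Quotient.mk I) := fun A B =>
    lc_ext fun n => map_add (Ideal.Quotient.mk I) _ _
  have hsmul : ∀ (c : F) (A : LaurentSeries V), (c • A).map (Ideal.Quotient.mk I) =
      c • A.map (Ideal.Quotient.mk I) := fun c A =>
    lc_ext fun n => map_smul (Ideal.Quotient.mkₐ F I) c _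
  have hcs : ∀ (c : F) (a : V), Ideal.Quotient.mk I (c • a) = c • Ideal.Quotient.mk I a :=
    fun c a => map_smul (Ideal.Quotient.mkₐ F I) c a
  refine ⟨LinearMap.mk₂ F (fun x y => (br x.out y.out).map (Ideal.Quotient.mk I))
    (fun x x' y => ?_) (fun c x y => ?_) (fun x y y' => ?_) (fun c x y => ?_), fun a b => ?_⟩
  · rw [← hadd, ← LinearMap.add_apply, ← map_add]
    exact hI.bracket_congr (by rw [map_add, hout, hout, hout]) rfl
  · rw [← hsmul, ← LinearMap.smul_apply, ← map_smul]
    exact hI.bracket_congr (by rw [hcs, hout, hout]) rfl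
  · rw [← hadd, ← map_add]
    exact hI.bracket_congr rfl (by rw [map_add, hout, hout, hout])
  · rw [← hsmul, ← map_smul]
    exact hI.bracket_congr rfl (by rw [hcs, hout, hout])
  · exact hI.bracket_congr (hout _) (hout _)

theorem IsPVA.of_isInduced {I : Ideal V} (hI : IsDiffIdeal D I) {br' : LamBracket F (V ⧸ I)}
    (hbr : IsPVA D br) (h : IsInduced I br br') : IsPVA (quotientDerivation D I hI) br' :=
  hbr.of_surjective (Ideal.Quotient.mkₐ F I) (Ideal.Quotient.mkₐ_surjective F I)
    (fun a => (quotientDerivation_mk D I hI a).symm) h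

theorem Compatible.of_isInduced {I : Ideal V} (hI : IsDiffIdeal D I) {br₀ br₁ : LamBracket F V}
    {br₀' br₁' : LamBracket F (V ⧸ I)} (hcomp : Compatible D br₀ br₁) (h₀ : IsInduced I br₀ br₀')
    (h₁ : IsInduced I br₁ br₁') : Compatible (quotientDerivation D I hI) br₀' br₁' where
  left := hcomp.left.of_isInduced hI h₀
  right := hcomp.right.of_isInduced hI h₁
  comb s t := (hcomp.comb s t).of_isInduced hI fun a b => lc_ext fun n => by
    have e : (s • br₀' + t • br₁') (Ideal.Quotient.mk I a) (Ideal.Quotient.mk I b) =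
        s • (br₀ a b).map (Ideal.Quotient.mk I) + t • (br₁ a b).map (Ideal.Quotient.mk I) := by
      rw [← h₀, ← h₁]
      rfl
    rw [e]
    exact ((map_add (Ideal.Quotient.mkₐ F I) _ _).trans
      (congrArg₂ (· + ·) (map_smul (Ideal.Quotient.mkₐ F I) s _)
        (map_smul (Ideal.Quotient.mkₐ F I) t _))).symm

end Quotients

end NonlocalPVA

open NonlocalPVA in
theorem theorem3p2 {F : Type*} [Field F] [CharZero F] {V : Type*} [CommRing V] [Algebra F V]
    (D : Derivation F V V) (br₀ br₁ : LamBracket F V) (hcomp : Compatible D br₀ br₁)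
    {m : ℕ} (θ : Fin m → V) (hcentral : ∀ i a, br₀ a (θ i) = 0)
    (K : Matrix (Fin m) (Fin m) (LaurentSeries V))
    (hK : IsInverse D (constraintMatrix br₁ θ) K) :
    Compatible D br₀ (diracModification D br₁ θ K) ∧
    IsPVAIdeal D br₀ (diffSpan D θ) ∧
    IsPVAIdeal D (diracModification D br₁ θ K) (diffSpan D θ) ∧
    ∃ br₀' br₁' : LamBracket F (V ⧸ diffSpan D θ),
      IsInduced (diffSpan D θ) br₀ br₀' ∧
      IsInduced (diffSpan D θ) (diracModification D br₁ θ K) br₁' ∧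
      Compatible (quotientDerivation D (diffSpan D θ) (diffSpan_isDiffIdeal D θ)) br₀' br₁' := by
  have hdirac := hcomp.dirac hcentral hK
  have hI₀ := hdirac.left.isPVAIdeal_diffSpan hcentral
  -- The θ_i are central for the modified bracket by construction, so the argument for central
  -- elements serves both brackets.
  have hI₁ := hdirac.right.isPVAIdeal_diffSpan fun i a => diracModification_constraint hK a i
  obtain ⟨br₀', h₀⟩ := hI₀.exists_isInduced
  obtain ⟨br₁', h₁⟩ := hI₁.exists_isInduced
  exact ⟨hdirac, hI₀, hI₁, br₀', br₁', h₀, h₁, hdirac.of_isInduced _ h₀ h₁⟩
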